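/- Let $k$ be a field of characteristic zero. A variety over $k$ is an integral separated scheme of finite type over $k$. Let $A$ be a semiabelian variety over $k$, that is, a group variety sitting in an exact sequence of group varieties over $k$ $$0\to \mathbb{G}_m^{\mu}\to A\xrightarrow{\ \rho\ } A_0\to 0$$ with $A_0$ an abelian variety. An equivariant completion of $A$ is a complete variety $X$ with an open immersion $A\hookrightarrow X$ such that the group law $A\times A\to A$ extends to a morphism $A\times X\to X$. Let $f=\sum_m c_m x^m$ be a Laurent polynomial in $\mu$ variables over $k$, and let $\Delta\subseteq\mathbb{R}^{\mu}$ be its Newton polyhedron, i.e. the convex hull of $\{m\in\mathbb{Z}^\mu : c_m\neq 0\}$; assume that $\Delta$ is not contained in any (affine) hyperplane and is non-empty. Let $n\ge 1$ be an integer so large that for every vertex $m$ of $n\Delta$ the differences $m'-m$, with $m'\in n\Delta\cap\mathbb{Z}^\mu$, generate the monoid of all lattice points in the cone they span. Let $m^{(0)},\dots,m^{(\ell)}$ be the lattice points of $n\Delta$, and let $\overline{G}$ be the closure of the image of $\mathbb{G}_m^{\mu}\to\mathbb{P}^{\ell}$, $t\mapsto[t^{m^{(0)}}:\dots:t^{m^{(\ell)}}]$.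 Let $\overline{A}$ be the equivariant completion of $A$ associated to $\Delta$: it is an equivariant completion of $A$ to which $\rho$ extends as a morphism $\bar\rho:\overline{A}\to A_0$, and $A_0$ is covered by open subsets $V$ having a section $s:V\to A$ of $\rho$ such that the trivialization $V\times\mathbb{G}_m^{\mu}\to\rho^{-1}(V)$, $(v,t)\mapsto s(v)\,t$, extends to an isomorphism $V\times\overline{G}\to\bar\rho^{-1}(V)$ over $V$. Let $T\subseteq\overline{A}$ be an orbit of $A$, that is, a non-empty reduced locally closed subscheme of $\overline{A}$ that is stable under $A$ and such that $A\times T\to T\times T$, $(a,t)\mapsto(at,t)$, is surjective. Then there exist an $A$-stable open subset $U$ of $\overline{A}$ containing $A$ and $T$, and an $A$-equivariant morphism $p:U\to T$ over $k$ whose restriction to $T$ is the identity. -/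

import Mathlib

open CategoryTheory Limits MonoidalCategory CartesianMonoidalCategory MonObj AlgebraicGeometry
open scoped Pointwise

universe u

noncomputable section

/-! ### Varieties, group varieties and semiabelian varieties -/

/-- A variety over `k`: an integral separated scheme of finite type over `k`. -/
structure IsVariety {k : Type u} [Field k] (X : Over (Spec (.of k))) : Prop where
  integral : IsIntegral X.left
  separated : IsSeparated X.hom
  locallyOfFiniteType : LocallyOfFiniteType X.hom
  quasiCompact : QuasiCompact X.hom

/-- An abelian variety over `k`: a proper geometrically integral group scheme over `k`. -/
structure IsAbelianVariety {k : Type u} [Field k] (A₀ : Over (Spec (.of k))) [GrpObj A₀] :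
    Prop where
  proper : IsProper A₀.hom
  geometricallyIntegral : GeometricallyIntegral A₀.hom

/-- The split torus `𝔾ₘ^r` over `k`, that is `Spec k[ℤ^r]` with its Hopf algebra structure. -/
abbrev splitTorus (k : Type u) [Field k] (r : ℕ) : Over (Spec (.of k)) :=
  (Spec (.of (AddMonoidAlgebra k (Fin r → ℤ)))).asOver (Spec (.of k))

/-- `0 → 𝔾ₘ^r → A → A₀ → 0` presents the group variety `A` as a semiabelian variety: `A₀` is an
abelian variety, `κ` and `ρ` are homomorphisms of group schemes, `κ` is the kernel of `ρ` and `ρ`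
is faithfully flat. -/
structure IsSemiabelian {k : Type u} [Field k] {r : ℕ} {A A₀ : Over (Spec (.of k))}
    [GrpObj A] [GrpObj A₀] (κ : splitTorus k r ⟶ A) (ρ : A ⟶ A₀) : Prop where
  variety : IsVariety A
  abelian : IsAbelianVariety A₀
  isMonHom_κ : IsMonHom κ
  isMonHom_ρ : IsMonHom ρ
  kernel : IsPullback κ (toUnit (splitTorus k r)) ρ η[A₀]
  surjective : Surjective ρ.left
  flat : Flat ρ.left

/-! ### Completions -/

/-- An equivariant completion of the group variety `G`: a complete variety `X` with an open
immersion `j : G ⟶ X` such that the group law `G × G ⟶ G` extends to a morphism `G × X ⟶ X`. -/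
structure EquivariantCompletion {k : Type u} [Field k] (G : Over (Spec (.of k))) [GrpObj G] where
  X : Over (Spec (.of k))
  variety : IsVariety X
  proper : IsProper X.hom
  j : G ⟶ X
  openImmersion : IsOpenImmersion j.left
  act : G ⊗ X ⟶ X
  act_extends : (G ◁ j) ≫ act = μ[G] ≫ j

/-- An open subset of a `k`-scheme, as a `k`-scheme. -/
abbrev openSub {k : Type u} [Field k] {X : Over (Spec (.of k))} (U : X.left.Opens) :
    Over (Spec (.of k)) :=
  Over.mk (U.ι ≫ X.hom)

/-- The inclusion of an open subset, as a morphism of `k`-schemes. -/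
abbrev openSubι {k : Type u} [Field k] {X : Over (Spec (.of k))} (U : X.left.Opens) :
    openSub U ⟶ X :=
  Over.homMk U.ι

/-! ### Newton polyhedra and their toric varieties -/

/-- The point of `ℝ^r` defined by a lattice point. -/
def toReal {r : ℕ} (m : Fin r → ℤ) : Fin r → ℝ := fun i => (m i : ℝ)

/-- The Newton polyhedron of the Laurent polynomial `f = ∑ c_m x^m`: the convex hull in `ℝ^r` of
`{m | c_m ≠ 0}`. -/
def newtonPolyhedron {k : Type u} [Field k] {r : ℕ} (f : AddMonoidAlgebra k (Fin r → ℤ)) :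
    Set (Fin r → ℝ) :=
  convexHull ℝ (toReal '' {m | f.coeff m ≠ 0})

/-- The lattice points of a subset of `ℝ^r`. -/
def latticePoints {r : ℕ} (Q : Set (Fin r → ℝ)) : Set (Fin r → ℤ) :=
  {m | toReal m ∈ Q}

/-- For every vertex `m` of `Q`, the differences `m' - m`, for `m'` a lattice point of `Q`,
generate the monoid of all lattice points of the cone that they span. -/
def VerticesGenerate {r : ℕ} (Q : Set (Fin r → ℝ)) : Prop :=
  ∀ m : Fin r → ℤ, toReal m ∈ Q.extremePoints ℝ →
    (AddSubmonoid.closure ((fun m' => m' - m) '' latticePoints Q) : Set (Fin r → ℤ)) =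
      {w | toReal w ∈ PointedCone.hull ℝ ((fun m' => toReal (m' - m)) '' latticePoints Q)}

section Toric

attribute [local instance] MvPolynomial.gradedAlgebra

variable (k : Type u) [Field k] {r : ℕ} (P : Set (Fin r → ℤ))

/-- Projective space over `k` with one homogeneous coordinate `x_m` for every `m ∈ P`. -/
abbrev projSpace : Scheme.{u} := Proj (MvPolynomial.homogeneousSubmodule P k)

/-- The structure morphism of projective space. -/
def projSpaceHom : projSpace k P ⟶ Spec (.of k) :=
  Proj.toSpecZero (MvPolynomial.homogeneousSubmodule P k) ≫
    Spec.map (CommRingCat.ofHom (algebraMap k (MvPolynomial.homogeneousSubmodule P k 0)))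

/-- The homomorphism `k[x_m | m ∈ P] → k[ℤ^r]` sending the variable `x_m` to the monomial `t^m`. -/
def monomialAlgHom : MvPolynomial P k →ₐ[k] AddMonoidAlgebra k (Fin r → ℤ) :=
  MvPolynomial.aeval (fun m : P => AddMonoidAlgebra.single m.1 1)

/-- The same homomorphism, with values in the global functions on the torus. -/
def monomialHom :
    MvPolynomial P k →+* Γ(Spec (.of (AddMonoidAlgebra k (Fin r → ℤ))), ⊤) :=
  (Scheme.ΓSpecIso (.of (AddMonoidAlgebra k (Fin r → ℤ)))).inv.hom.comp
    (monomialAlgHom k P).toRingHom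

variable {P}

theorem monomialHom_irrelevant (hP : P.Nonempty) :
    (HomogeneousIdeal.irrelevant (MvPolynomial.homogeneousSubmodule P k)).toIdeal.map
      (monomialHom k P) = ⊤ := by
  obtain ⟨m, hm⟩ := hP
  have hX : (MvPolynomial.X ⟨m, hm⟩ : MvPolynomial P k) ∈
      (HomogeneousIdeal.irrelevant (MvPolynomial.homogeneousSubmodule P k)).toIdeal :=
    HomogeneousIdeal.mem_irrelevant_of_mem _ Nat.one_pos (MvPolynomial.isHomogeneous_X k _)
  refine Ideal.eq_top_of_isUnit_mem _ (Ideal.mem_map_of_mem _ hX) ?_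
  have hu : IsUnit (monomialAlgHom k P (MvPolynomial.X ⟨m, hm⟩)) := by
    refine IsUnit.of_mul_eq_one (AddMonoidAlgebra.single (-m) 1) ?_
    simp [monomialAlgHom, AddMonoidAlgebra.single_mul_single, AddMonoidAlgebra.one_def]
  exact hu.map (Scheme.ΓSpecIso (.of (AddMonoidAlgebra k (Fin r → ℤ)))).inv.hom

/-- The morphism `t ↦ [t^m]_{m ∈ P}` from the torus to projective space. -/
def monomialMap (hP : P.Nonempty) :
    Spec (.of (AddMonoidAlgebra k (Fin r → ℤ))) ⟶ projSpace k P :=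
  Proj.fromOfGlobalSections (MvPolynomial.homogeneousSubmodule P k) (monomialHom k P)
    (monomialHom_irrelevant k hP)

theorem monomialMap_comp (hP : P.Nonempty) :
    monomialMap k hP ≫ projSpaceHom k P = (splitTorus k r).hom := by
  rw [monomialMap, projSpaceHom, Proj.fromOfGlobalSections_toSpecZero_assoc, ← Spec.map_comp,
    ← CommRingCat.ofHom_comp]
  have h : ((monomialHom k P).comp (algebraMap (MvPolynomial.homogeneousSubmodule P k 0) _)).comp
      (algebraMap k (MvPolynomial.homogeneousSubmodule P k 0)) =
      (Scheme.ΓSpecIso (.of (AddMonoidAlgebra k (Fin r → ℤ)))).inv.hom.comp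
        (algebraMap k (AddMonoidAlgebra k (Fin r → ℤ))) := by
    refine RingHom.ext fun x => ?_
    exact congrArg (Scheme.ΓSpecIso (.of (AddMonoidAlgebra k (Fin r → ℤ)))).inv.hom
      ((monomialAlgHom k P).commutes x)
  rw [h]
  have h2 : CommRingCat.ofHom ((Scheme.ΓSpecIso
        (.of (AddMonoidAlgebra k (Fin r → ℤ)))).inv.hom.comp
        (algebraMap k (AddMonoidAlgebra k (Fin r → ℤ)))) =
      CommRingCat.ofHom (algebraMap k (AddMonoidAlgebra k (Fin r → ℤ))) ≫
        (Scheme.ΓSpecIso (.of (AddMonoidAlgebra k (Fin r → ℤ)))).inv := rfl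
  rw [h2, Spec.map_comp, toSpecΓ_SpecMap_ΓSpecIso_inv_assoc]
  rfl

/-- The closure of the image of the torus in projective space under `t ↦ [t^m]_{m ∈ P}`. -/
def toricVariety (hP : P.Nonempty) : Over (Spec (.of k)) :=
  Over.mk ((monomialMap k hP).imageι ≫ projSpaceHom k P)

/-- The morphism from the torus to the closure of its image. -/
def torusToToric (hP : P.Nonempty) : splitTorus k r ⟶ toricVariety k hP :=
  Over.homMk (monomialMap k hP).toImage (by
    change (monomialMap k hP).toImage ≫ (monomialMap k hP).imageι ≫ projSpaceHom k P = _
    rw [Scheme.Hom.toImage_imageι_assoc, monomialMap_comp])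

end Toric

theorem latticePoints_nonempty {k : Type u} [Field k] {r : ℕ}
    {f : AddMonoidAlgebra k (Fin r → ℤ)}
    (hf : affineSpan ℝ (newtonPolyhedron f) = ⊤) (n : ℕ) :
    (latticePoints ((n : ℝ) • newtonPolyhedron f)).Nonempty := by
  have hne : (affineSpan ℝ (newtonPolyhedron f) : Set (Fin r → ℝ)).Nonempty := by
    rw [hf]; exact Set.univ_nonempty
  rw [affineSpan_nonempty, newtonPolyhedron, convexHull_nonempty_iff, Set.image_nonempty] at hne
  obtain ⟨m, hm⟩ := hne
  refine ⟨n • m, toReal m, subset_convexHull ℝ _ ⟨m, hm, rfl⟩, ?_⟩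
  ext i
  simp [toReal]

/-! ### The completion of a semiabelian variety associated to a Newton polyhedron -/

/-- Let `κ` and `ρ` present `A` as an extension of `A₀` by a split torus `𝔾ₘ^r`, and let
`e : 𝔾ₘ^r ⟶ Gbar` be a partial compactification of that torus. `Abar` is obtained from
`A` by the base change of the fibre from `𝔾ₘ^r` to `Gbar`: the map `ρ` extends to `ρbar : Abar ⟶ A₀`,
and `A₀` is covered by open subsets `V` with a section `s` of `ρ` over `V`, such that the
trivialization `(v, t) ↦ s(v) κ(t)` of the torsor `ρ⁻¹(V)` extends to an isomorphism
from `V × Gbar` to `ρbar⁻¹(V)`. -/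
def IsAssociatedCompletion {k : Type u} [Field k] {r : ℕ} {A A₀ : Over (Spec (.of k))}
    [GrpObj A] (κ : splitTorus k r ⟶ A) (ρ : A ⟶ A₀)
    {Gbar : Over (Spec (.of k))} (e : splitTorus k r ⟶ Gbar)
    (Abar : EquivariantCompletion A) : Prop :=
  ∃ ρbar : Abar.X ⟶ A₀, Abar.j ≫ ρbar = ρ ∧
    ∀ x : A₀.left, ∃ V : A₀.left.Opens, x ∈ V ∧
      ∃ (s : openSub V ⟶ A) (c : openSub V ⊗ Gbar ⟶ Abar.X),
        s ≫ ρ = openSubι V ∧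
        (openSub V ◁ e) ≫ c = (s ⊗ₘ κ) ≫ μ[A] ≫ Abar.j ∧
        IsPullback c (fst (openSub V) Gbar) ρbar (openSubι V)

/-- `Abar` is the equivariant completion of `A` associated to the Newton polyhedron of `f`,
where that polyhedron does not lie in a hyperplane: its fibre is the closure of the torus in
projective space under the monomials `t^m`, for `m` a lattice point of a multiple `n • Δ` of the
Newton polyhedron `Δ` with `n` so large that the lattice points generate the monoids at all
vertices. -/
def IsNewtonCompletion {k : Type u} [Field k] {r : ℕ} {A A₀ : Over (Spec (.of k))}
    [GrpObj A] (κ : splitTorus k r ⟶ A) (ρ : A ⟶ A₀)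
    (f : AddMonoidAlgebra k (Fin r → ℤ)) (hf : affineSpan ℝ (newtonPolyhedron f) = ⊤)
    (Abar : EquivariantCompletion A) : Prop :=
  ∃ n : ℕ, 0 < n ∧ VerticesGenerate ((n : ℝ) • newtonPolyhedron f) ∧
    IsAssociatedCompletion κ ρ (torusToToric k (latticePoints_nonempty hf n)) Abar

/-! ### Orbits and equivariant projections -/

/-- `actT : G × T ⟶ T` is the restriction of `act : G × X ⟶ X` along `i : T ⟶ X`. -/
def IsRestriction {k : Type u} [Field k] {G X T : Over (Spec (.of k))} (act : G ⊗ X ⟶ X)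
    (i : T ⟶ X) (actT : G ⊗ T ⟶ T) : Prop :=
  actT ≫ i = (G ◁ i) ≫ act

/-- `i : T ⟶ X` is the inclusion of an orbit: a nonempty reduced locally closed subscheme which is
stable under `G` and on which `G` acts transitively, that is, `(g, t) ↦ (g t, t)` is a surjective
morphism `G × T ⟶ T × T`. -/
structure IsOrbit {k : Type u} [Field k] {G X T : Over (Spec (.of k))} (act : G ⊗ X ⟶ X)
    (i : T ⟶ X) : Prop where
  immersion : IsImmersion i.left
  reduced : IsReduced T.left
  nonempty : Nonempty T.left
  transitive : ∃ actT : G ⊗ T ⟶ T, IsRestriction act i actT ∧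
    Surjective (lift actT (snd G T)).left

/-- `p : U ⟶ T`, for an open subset `U` of `X` and a subscheme `i : T ⟶ X`, is equivariant for the
action of `G` on `X`: `U` and `T` are stable under `G`, and `p` commutes with the actions. -/
def IsEquivariantMap {k : Type u} [Field k] {G X T : Over (Spec (.of k))} (act : G ⊗ X ⟶ X)
    (i : T ⟶ X) {U : X.left.Opens} (p : openSub U ⟶ T) : Prop :=
  ∃ (actU : G ⊗ openSub U ⟶ openSub U) (actT : G ⊗ T ⟶ T),
    IsRestriction act (openSubι U) actU ∧ IsRestriction act i actT ∧
      actU ≫ p = (G ◁ p) ≫ actT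

end

/-! Write N for the torus and X for the completion. An affine toric chart W = Spec k[S] is a monoid
scheme containing N. Sending a monomial to 1 if it is invertible in k[S] and to 0 otherwise defines
an idempotent w₀ ∈ W(k), and w ↦ w w₀ retracts W onto the orbit N w₀, the closed one, compatibly
with N.

The action of A spreads this retraction over X. Translating a local trivialization to the origin of
A₀ gives an embedding c of W into the fibre of X there. The map q(a, w) = a c(w) identifies only (a
κ(t), w) with (a, t w), so a c(w w₀) depends only on q(a, w)
(`IsEquivariantFibre.comp_eq_of_comp_eq`). Sections of ρ over open V turn q into open immersions V ×
W → X, so the image U of q is open and the map descends to p on U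
(`exists_open_range_of_local_sections`). The image of p is the orbit of c(w₀), and p is the identity
there because w₀² = w₀.

It remains to choose W with N w₀ meeting T in suitable local coordinates. `exists_toric_chart`
shrinks a chart until every monomial not vanishing at a given point is invertible, and
`mem_range_torusToSpec_mul` shows that the point then lies on N w₀. `IsOrbit.range_eq` identifies T
with the orbit of c(w₀), and `exists_equivariant_projection` assembles the argument.

Identities such as the action axioms are checked on A or N, which are scheme-theoretically dense,
and remain so after products over k. As k need not be algebraically closed, pairs of points are
replaced by generalized points or by points of fibre products. -/

/-! ### Scheme-theoretic density -/

theorem IsSchemeTheoreticallyDominant.hom_ext {X Y Z S : Scheme.{u}} (f : X ⟶ Y)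
    [IsSchemeTheoreticallyDominant f] (s : Z ⟶ S) [IsSeparated s] {g h : Y ⟶ Z}
    (hs : g ≫ s = h ≫ s) (H : f ≫ g = f ≫ h) : g = h := by
  let Y' : Over S := Over.mk (g ≫ s)
  let Z' : Over S := Over.mk s
  let g' : Y' ⟶ Z' := Over.homMk g
  let h' : Y' ⟶ Z' := Over.homMk h hs.symm
  let f' : Over.mk (f ≫ g ≫ s) ⟶ Y' := Over.homMk f
  have : IsSeparated Z'.hom := ‹_›
  let l := equalizer.lift (f := g') (g := h') f' (by ext; exact H)
  have hl : l.left ≫ (equalizer.ι g' h').left = f := by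
    rw [← Over.comp_left, equalizer.lift_ι]; rfl
  -- The equalizer is a closed subscheme through which `f` factors, so its ideal is contained in the
  -- zero ideal `f.ker`.
  have : IsIso (equalizer.ι g' h').left := by
    rw [IsClosedImmersion.isIso_iff_ker_eq_bot, ← le_bot_iff, ← f.ker_eq_bot, ← hl]
    exact Scheme.Hom.le_ker_comp _ _
  rw [← cancel_epi (equalizer.ι g' h').left]
  exact congr($(equalizer.condition g' h').left)

/-- The morphism from a scheme to the scheme-theoretic image is scheme-theoretically dominant. -/
instance isSchemeTheoreticallyDominant_toImage {X Y : Scheme.{u}} (f : X ⟶ Y) :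
    IsSchemeTheoreticallyDominant f.toImage := by
  -- `f` also factors through the image of `f.toImage`, seen as a closed subscheme of `Y`;
  -- minimality of the image of `f` forces the two ideals to agree.
  have h : IsIso f.toImage.imageι := by
    refine IsClosedImmersion.isIso_of_ker_eq (f.toImage.imageι ≫ f.imageι) f.imageι _ rfl
      (le_antisymm ?_ (Scheme.Hom.le_ker_comp _ _))
    calc (f.toImage.imageι ≫ f.imageι).ker
        ≤ (f.toImage.toImage ≫ f.toImage.imageι ≫ f.imageι).ker := Scheme.Hom.le_ker_comp _ _
      _ = f.imageι.ker := by simp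
  rw [IsClosedImmersion.isIso_iff_ker_eq_bot] at h
  exact ⟨by simpa using h⟩

/-! ### Group actions on generalized points -/

section Cartesian

variable {C : Type*} [Category* C] [CartesianMonoidalCategory C]

theorem isPullback_whiskerLeft_snd (Y : C) {U X : C} (f : U ⟶ X) :
    IsPullback (Y ◁ f) (snd Y U) (snd Y X) f := by
  refine ⟨⟨by simp⟩, ⟨PullbackCone.IsLimit.mk _
    (fun s => lift (s.fst ≫ fst Y X) s.snd) (fun s => ?_) (fun s => ?_) (fun s m h1 h2 => ?_)⟩⟩
  · ext
    · simp
    · simpa using s.condition.symm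
  · simp
  · ext
    · simp [← h1]
    · simp [h2]

variable {G X : C} [GrpObj G] (act : G ⊗ X ⟶ X)

/-- `act` is an action of the group object `G` on `X`, expressed on generalized points. -/
structure IsGroupAction : Prop where
  one_act : ∀ {Z : C} (x : Z ⟶ X), lift (1 : Z ⟶ G) x ≫ act = x
  mul_act : ∀ {Z : C} (a b : Z ⟶ G) (x : Z ⟶ X),
    lift (a * b) x ≫ act = lift a (lift b x ≫ act) ≫ act

theorem IsGroupAction.inv_act {act : G ⊗ X ⟶ X} (h : IsGroupAction act) {Z : C} (a : Z ⟶ G)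
    (x : Z ⟶ X) : lift a⁻¹ (lift a x ≫ act) ≫ act = x := by
  rw [← h.mul_act, inv_mul_cancel, h.one_act]

end Cartesian

/-! ### Density over a field and the action on an equivariant completion -/

section Over

variable {k : Type u} [Field k]

instance flat_snd_left (X Y : Over (Spec (.of k))) : Flat (snd X Y).left :=
  inferInstanceAs (Flat (pullback.snd X.hom Y.hom))

theorem isPullback_whiskerLeft_snd_left (Y : Over (Spec (.of k))) {U X : Over (Spec (.of k))}
    (f : U ⟶ X) : IsPullback (Y ◁ f).left (snd Y U).left (snd Y X).left f.left :=
  (isPullback_whiskerLeft_snd Y f).map (Over.forget _)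

instance isSchemeTheoreticallyDominant_whiskerLeft (Y : Over (Spec (.of k)))
    {U X : Over (Spec (.of k))} (f : U ⟶ X) [IsSchemeTheoreticallyDominant f.left]
    [QuasiCompact f.left] : IsSchemeTheoreticallyDominant (Y ◁ f).left :=
  .of_isPullback (isPullback_whiskerLeft_snd_left Y f).flip

/-- Morphisms to a separated scheme over a field that agree on a scheme-theoretically dense
subobject are equal. -/
theorem Over.hom_ext_of_dominant {U X Z : Over (Spec (.of k))} (f : U ⟶ X)
    [IsSchemeTheoreticallyDominant f.left] (hZ : IsSeparated Z.hom) {g h : X ⟶ Z}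
    (H : f ≫ g = f ≫ h) : g = h := by
  ext1
  refine IsSchemeTheoreticallyDominant.hom_ext f.left Z.hom (by simp) ?_
  simpa using congr($(H).left)

/-- A point of a product over `k` is more than a pair of points; the cartesian square of `Y ◁ f`
with the second projections supplies the lift instead. -/
theorem exists_whiskerLeft_eq (Y : Over (Spec (.of k))) {U X : Over (Spec (.of k))} (f : U ⟶ X)
    (z : (Y ⊗ X).left) (x : U.left) (h : (snd Y X).left z = f.left x) :
    ∃ z', (Y ◁ f).left z' = z ∧ (snd Y U).left z' = x := by
  have H := isPullback_whiskerLeft_snd_left Y f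
  obtain ⟨w, h1, h2⟩ := Scheme.Pullback.exists_preimage_pullback z x h
  refine ⟨H.isoPullback.inv w, ?_, ?_⟩
  · rw [← Scheme.Hom.comp_apply, H.isoPullback_inv_fst, h1]
  · rw [← Scheme.Hom.comp_apply, H.isoPullback_inv_snd, h2]

/-- The action of `G` on an equivariant completion extends the left translations of `G`. -/
theorem EquivariantCompletion.lift_comp_act {G : Over (Spec (.of k))} [GrpObj G]
    (X : EquivariantCompletion G) {Z : Over (Spec (.of k))} (a b : Z ⟶ G) :
    lift a (b ≫ X.j) ≫ X.act = (a * b) ≫ X.j := by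
  rw [← lift_whiskerLeft_assoc, X.act_extends, ← Category.assoc, ← Hom.mul_def]

theorem EquivariantCompletion.isSchemeTheoreticallyDominant_j {G : Over (Spec (.of k))} [GrpObj G]
    (X : EquivariantCompletion G) : IsSchemeTheoreticallyDominant X.j.left := by
  have := X.variety.integral
  have := X.openImmersion
  have : Nonempty G.left := ⟨η[G].left (IsLocalRing.closedPoint k)⟩
  have : IsDominant X.j.left :=
    ⟨X.j.left.isOpenEmbedding.isOpen_range.dense (Set.range_nonempty _)⟩
  exact .of_isDominant _

theorem EquivariantCompletion.quasiCompact_j {G : Over (Spec (.of k))} [GrpObj G]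
    (X : EquivariantCompletion G) (hG : QuasiCompact G.hom) : QuasiCompact X.j.left := by
  have := X.variety.separated
  have hj : QuasiCompact (X.j.left ≫ X.X.hom) := by simpa
  exact .of_comp X.j.left X.X.hom

/-- The action map of an equivariant completion is an action. -/
theorem EquivariantCompletion.isGroupAction {G : Over (Spec (.of k))} [GrpObj G]
    (X : EquivariantCompletion G) (hG : QuasiCompact G.hom) : IsGroupAction X.act := by
  have := X.quasiCompact_j hG
  have := X.isSchemeTheoreticallyDominant_j
  -- Both axioms are proved for universal points; by density they reduce to the open subset `G`,
  -- where they are the group laws.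
  have hone : lift (1 : X.X ⟶ G) (𝟙 X.X) ≫ X.act = 𝟙 _ := by
    refine Over.hom_ext_of_dominant X.j X.variety.separated ?_
    have := X.lift_comp_act 1 (𝟙 G)
    rw [_root_.one_mul] at this
    simpa [comp_lift_assoc, MonObj.comp_one] using this
  have hmul : lift (fst _ _ ≫ fst _ _ * fst _ _ ≫ snd _ _) (snd (G ⊗ G) X.X) ≫ X.act =
      lift (fst _ _ ≫ fst _ _)
        (lift (fst _ _ ≫ snd _ _) (snd (G ⊗ G) X.X) ≫ X.act) ≫ X.act := by
    refine Over.hom_ext_of_dominant ((G ⊗ G) ◁ X.j) X.variety.separated ?_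
    simp only [comp_lift_assoc, MonObj.comp_mul, whiskerLeft_fst_assoc, whiskerLeft_snd,
      X.lift_comp_act, _root_.mul_assoc]
  refine ⟨fun {Z} x => ?_, fun {Z} a b x => ?_⟩
  · simpa [comp_lift_assoc, MonObj.comp_one] using congr(x ≫ $hone)
  · simpa [comp_lift_assoc, comp_lift, MonObj.comp_mul] using congr(lift (lift a b) x ≫ $hmul)

end Over

/-! ### Charts of morphisms to Proj and of scheme-theoretic images -/

section Proj

variable {σ : Type*} {A : Type u} [CommRing A] [SetLike σ A] [AddSubgroupClass σ A]
  (𝒜 : ℕ → σ) [GradedRing 𝒜]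

/-- A morphism to `Proj 𝒜` defined by global sections factors through `D₊(t)` if `t` is sent to a
unit. -/
theorem Proj.fromOfGlobalSections_eq_awayι {X : Scheme.{u}} (f : A →+* Γ(X, ⊤))
    (hf : (HomogeneousIdeal.irrelevant 𝒜).toIdeal.map f = ⊤) {t : A} {d : ℕ} (hd : 0 < d)
    (ht : t ∈ 𝒜 d) (hu : IsUnit (f t)) :
    Proj.fromOfGlobalSections 𝒜 f hf = X.toSpecΓ ≫
      Spec.map (CommRingCat.ofHom ((IsLocalization.Away.lift t hu).comp
        (algebraMap (HomogeneousLocalization.Away 𝒜 t) (Localization.Away t)))) ≫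
      Proj.awayι 𝒜 t ht hd := by
  -- Since `f t` is a unit, the piece of the glueing cover that belongs to `t` is all of `X`.
  have hU : X.basicOpen (f t) = ⊤ := X.basicOpen_of_isUnit hu
  have : IsIso (X.basicOpen (f t)).ι := by
    rw [hU, ← Scheme.topIso_hom]; infer_instance
  rw [← cancel_epi (X.basicOpen (f t)).ι]
  have h1 : (X.basicOpen (f t)).ι ≫ Proj.fromOfGlobalSections 𝒜 f hf =
      Proj.toBasicOpenOfGlobalSections 𝒜 f rfl hd ht ≫ (Proj.basicOpen 𝒜 t).ι :=
    (Proj.openCoverOfMapIrrelevantEqTop 𝒜 f hf).ι_glueMorphisms _ _ ⟨_, _, hd, ht⟩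
  rw [h1, Proj.toBasicOpenOfGlobalSections]
  simp only [Category.assoc, Proj.basicOpenIsoSpec_inv_ι]
  have h2 : ∀ h, (IsLocalization.map (M := .powers t) (T := .powers (f t))
        (Localization.Away (f t)) f h).comp
          (algebraMap (HomogeneousLocalization.Away 𝒜 t) (Localization.Away t)) =
      (algebraMap _ (Localization.Away (f t))).comp ((IsLocalization.Away.lift t hu).comp
        (algebraMap (HomogeneousLocalization.Away 𝒜 t) (Localization.Away t))) := by
    intro h
    rw [← RingHom.comp_assoc]
    congr 1
    refine IsLocalization.ringHom_ext (.powers t) (RingHom.ext fun x => ?_)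
    simp
  rw [h2, CommRingCat.ofHom_comp, Spec.map_comp, Category.assoc,
    basicOpenIsoSpecAway_hom_SpecMap_assoc]
  have h3 : ∀ (U : (Spec Γ(X, ⊤)).Opens) (h : X.toSpecΓ ⁻¹ᵁ U = X.basicOpen (f t))
      {Z : Scheme.{u}} (g : Spec Γ(X, ⊤) ⟶ Z), (X.isoOfEq h).inv ≫ X.toSpecΓ ∣_ U ≫ U.ι ≫ g =
        (X.basicOpen (f t)).ι ≫ X.toSpecΓ ≫ g := by
    intro U h Z g
    rw [morphismRestrict_ι_assoc, Scheme.isoOfEq_inv, Scheme.homOfLE_ι_assoc]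
  exact h3 _ (X.toSpecΓ_preimage_basicOpen (f t)) _

end Proj

section ClosedImmersion

/-- A scheme-theoretic image is, over an open subset, any closed subscheme in which the given
scheme is scheme-theoretically dense. -/
theorem exists_isOpenImmersion_image {X Y U Z : Scheme.{u}} (f : X ⟶ Y) [QuasiCompact f]
    (j : U ⟶ Y) [IsOpenImmersion j] (i : Z ⟶ U) [IsClosedImmersion i] (g : X ⟶ Z)
    [IsSchemeTheoreticallyDominant g] (h : g ≫ i ≫ j = f) :
    ∃ o : Z ⟶ f.image, IsOpenImmersion o ∧ g ≫ o = f.toImage ∧ o ≫ f.imageι = i ≫ j ∧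
      Set.range o = f.imageι ⁻¹' Set.range j := by
  -- `X` is scheme-theoretically dense in the restriction `P` of the image to `U` and in `Z`, so
  -- both are closed in `U` with the same ideal, the kernel of `X ⟶ U`.
  let P := pullback f.imageι j
  let l : X ⟶ P := pullback.lift f.toImage (g ≫ i) (by simp [h])
  have hl1 : l ≫ pullback.fst f.imageι j = f.toImage := pullback.lift_fst ..
  have hl2 : l ≫ pullback.snd f.imageι j = g ≫ i := pullback.lift_snd ..
  have hl : IsPullback (𝟙 X) l f.toImage (pullback.fst f.imageι j) := by
    refine ⟨⟨by simp [hl1]⟩, ⟨PullbackCone.IsLimit.mk _ (fun s => s.fst) (by simp) (fun s => ?_)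
      (by simp)⟩⟩
    rw [← cancel_mono (pullback.fst f.imageι j)]
    simpa [hl1] using s.condition
  have hl' : IsSchemeTheoreticallyDominant l := .of_isPullback hl
  have hker : ∀ {W V : Scheme.{u}} (a : X ⟶ W) (b : W ⟶ V) [IsSchemeTheoreticallyDominant a]
      [IsClosedImmersion b], (a ≫ b).ker = b.ker := fun a b _ _ => by
    rw [Scheme.Hom.ker_comp, a.ker_eq_bot, Scheme.IdealSheafData.map_bot]
  have hk : (pullback.snd f.imageι j).ker = i.ker := by
    rw [← hker l, ← hker g i]; congr 1
  have := IsClosedImmersion.isIso_lift (pullback.snd f.imageι j) i hk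
  refine ⟨IsClosedImmersion.lift (pullback.snd f.imageι j) i hk.le ≫ pullback.fst _ _,
    inferInstance, ?_, ?_, ?_⟩
  · rw [← cancel_mono f.imageι]
    simp [pullback.condition, h]
  · simp [pullback.condition]
  · rw [Scheme.Hom.comp_base, TopCat.coe_comp, Set.range_comp,
      Set.range_eq_univ.mpr (Scheme.Hom.surjective _), Set.image_univ,
      Scheme.Pullback.range_fst]

end ClosedImmersion

/-! ### Monoid algebras and their monomial localizations -/

section MonoidAlgebra

variable (k : Type u) [Field k] {r : ℕ}

/-- The inclusion of the monoid algebras of two submonoids of a lattice. -/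
noncomputable def monoidAlgebraInclusion {S S' : AddSubmonoid (Fin r → ℤ)} (h : S ≤ S') :
    AddMonoidAlgebra k S →ₐ[k] AddMonoidAlgebra k S' :=
  AddMonoidAlgebra.mapDomainAlgHom k k (AddSubmonoid.inclusion h)

/-- The inclusion of the monoid algebra of a submonoid of a lattice in the group algebra. -/
noncomputable def monoidAlgebraSubtype (S : AddSubmonoid (Fin r → ℤ)) :
    AddMonoidAlgebra k S →ₐ[k] AddMonoidAlgebra k (Fin r → ℤ) :=
  AddMonoidAlgebra.mapDomainAlgHom k k S.subtype

variable {k}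

@[simp]
theorem monoidAlgebraInclusion_single {S S' : AddSubmonoid (Fin r → ℤ)} (h : S ≤ S') (s : S)
    (c : k) : monoidAlgebraInclusion k h (.single s c) = .single ⟨s, h s.2⟩ c := by
  simp [monoidAlgebraInclusion]; rfl

@[simp]
theorem monoidAlgebraSubtype_single {S : AddSubmonoid (Fin r → ℤ)} (s : S)
    (c : k) : monoidAlgebraSubtype k S (.single s c) = .single s.1 c := by
  simp [monoidAlgebraSubtype]

theorem monoidAlgebraSubtype_injective (S : AddSubmonoid (Fin r → ℤ)) :
    Function.Injective (monoidAlgebraSubtype k S) :=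
  AddMonoidAlgebra.mapDomain_injective Subtype.val_injective

theorem monoidAlgebraInclusion_injective {S S' : AddSubmonoid (Fin r → ℤ)} (h : S ≤ S') :
    Function.Injective (monoidAlgebraInclusion k h) :=
  AddMonoidAlgebra.mapDomain_injective (Set.inclusion_injective h)

theorem monoidAlgebraSubtype_comp_inclusion {S S' : AddSubmonoid (Fin r → ℤ)} (h : S ≤ S') :
    (monoidAlgebraSubtype k S').comp (monoidAlgebraInclusion k h) = monoidAlgebraSubtype k S := by
  ext s; simp

/-- Inverting the monomial of exponent `u`. -/
theorem isLocalization_monoidAlgebraInclusion {S S' : AddSubmonoid (Fin r → ℤ)} (h : S ≤ S')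
    (u : S) (hS' : S' = S ⊔ AddSubmonoid.closure {-u.1}) :
    letI := (monoidAlgebraInclusion k h).toRingHom.toAlgebra
    IsLocalization.Away (AddMonoidAlgebra.single u 1 : AddMonoidAlgebra k S)
      (AddMonoidAlgebra k S') := by
  let := (monoidAlgebraInclusion k h).toRingHom.toAlgebra
  have ha : ∀ x, algebraMap (AddMonoidAlgebra k S) (AddMonoidAlgebra k S') x =
    monoidAlgebraInclusion k h x := fun _ => rfl
  have hu : -u.1 ∈ S' := by
    rw [hS']; exact le_sup_right (a := S) (AddSubmonoid.subset_closure rfl)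
  refine ⟨?_, ?_, ?_⟩
  · rintro ⟨_, n, rfl⟩
    rw [map_pow]
    refine .pow _ (IsUnit.of_mul_eq_one (.single ⟨-u.1, hu⟩ 1) ?_)
    rw [ha, monoidAlgebraInclusion_single, AddMonoidAlgebra.single_mul_single,
      AddMonoidAlgebra.one_def]
    congr 1
    · ext1; simp
    · simp
  · intro z
    suffices H : ∃ n : ℕ, ∃ x, z * monoidAlgebraInclusion k h ((.single u 1) ^ n) =
        monoidAlgebraInclusion k h x by
      obtain ⟨n, x, hx⟩ := H
      exact ⟨⟨x, ⟨_, n, rfl⟩⟩, hx⟩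
    induction z using AddMonoidAlgebra.induction_linear with
    | zero => exact ⟨0, 0, by simp⟩
    | add x y hx hy =>
      obtain ⟨n, x', hx⟩ := hx
      obtain ⟨m, y', hy⟩ := hy
      refine ⟨n + m, x' * (.single u 1) ^ m + y' * (.single u 1) ^ n, ?_⟩
      rw [map_add, map_mul, map_mul, ← hx, ← hy, pow_add, map_mul]
      ring
    | single s c =>
      have hs := s.2
      simp only [hS'] at hs
      obtain ⟨a, ha', b, hb, hab⟩ := AddSubmonoid.mem_sup.1 hs
      obtain ⟨n, rfl⟩ := AddSubmonoid.mem_closure_singleton.1 hb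
      refine ⟨n, .single ⟨a, ha'⟩ c, ?_⟩
      rw [map_pow, monoidAlgebraInclusion_single, monoidAlgebraInclusion_single,
        AddMonoidAlgebra.single_pow, AddMonoidAlgebra.single_mul_single]
      congr 1
      · ext1
        simp [← hab]
      · simp
  · intro x y hxy
    exact ⟨1, by rw [monoidAlgebraInclusion_injective h hxy]⟩

open PrimeSpectrum in
/-- A prime ideal of the monoid algebra of a finitely generated monoid `S` extends to a prime ideal
of a localization at one monomial, such that the monomials outside of this prime are invertible. -/
theorem exists_localization_monomials {S : AddSubmonoid (Fin r → ℤ)} (hS : S.FG)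
    (y : PrimeSpectrum (AddMonoidAlgebra k S)) :
    ∃ (S' : AddSubmonoid (Fin r → ℤ)) (h : S ≤ S') (y' : PrimeSpectrum (AddMonoidAlgebra k S')),
      IsOpenImmersion (Spec.map (CommRingCat.ofHom (monoidAlgebraInclusion k h).toRingHom)) ∧
      comap (monoidAlgebraInclusion k h).toRingHom y' = y ∧
      ∀ s : S', .single s 1 ∉ y'.asIdeal → -s.1 ∈ S' := by
  classical
  obtain ⟨t, ht⟩ := hS
  -- `F` is a face of `S`: a sum lies in it exactly when both summands do. It is therefore generated
  -- by the generators of `S` that it contains, and inverting the sum `u` of these inverts all of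
  -- `F`.
  let F : Set S := {s | (.single s 1 : AddMonoidAlgebra k S) ∉ y.asIdeal}
  have hF : ∀ a b : S, a + b ∈ F ↔ a ∈ F ∧ b ∈ F := fun a b => by
    have : (.single (a + b) 1 : AddMonoidAlgebra k S) = .single a 1 * .single b 1 := by
      rw [AddMonoidAlgebra.single_mul_single, _root_.mul_one]
    simp only [F, Set.mem_ofPred_eq, this, y.2.mul_mem_iff_mem_or_mem, not_or]
  have hF0 : 0 ∈ F := by
    simp only [F, Set.mem_ofPred_eq, ← AddMonoidAlgebra.one_def]
    exact y.2.one_notMem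
  let t' : Finset S := (t.preimage Subtype.val Subtype.val_injective.injOn).filter (· ∈ F)
  let u : S := ∑ g ∈ t', g
  have huF : u ∈ F := by
    have : ∀ t'' ⊆ t', ∑ g ∈ t'', g ∈ F := by
      intro t''
      induction t'' using Finset.induction_on with
      | empty => intro _; simpa using hF0
      | insert a b hab ih =>
        intro hb
        rw [Finset.sum_insert hab, hF]
        refine ⟨(Finset.mem_filter.1 (hb (Finset.mem_insert_self _ _))).2,
          ih ((Finset.subset_insert _ _).trans hb)⟩
    exact this t' subset_rfl
  let S' := S ⊔ AddSubmonoid.closure {-u.1}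
  have h : S ≤ S' := le_sup_left
  have huS' : -u.1 ∈ S' := le_sup_right (a := S) (AddSubmonoid.subset_closure rfl)
  let := (monoidAlgebraInclusion k h).toRingHom.toAlgebra
  have hloc : IsLocalization.Away (AddMonoidAlgebra.single u 1 : AddMonoidAlgebra k S)
      (AddMonoidAlgebra k S') := isLocalization_monoidAlgebraInclusion h u rfl
  have hy : y ∈ Set.range (comap (algebraMap (AddMonoidAlgebra k S) (AddMonoidAlgebra k S'))) := by
    rw [localization_away_comap_range _ (.single u 1)]
    exact huF
  obtain ⟨y', hy'⟩ := hy
  have hS : ∀ {s}, s ∈ AddSubmonoid.closure (t : Set (Fin r → ℤ)) → s ∈ S := fun hs => ht ▸ hs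
  have hgen : ∀ s (hs : s ∈ AddSubmonoid.closure (t : Set (Fin r → ℤ))),
      (⟨s, hS hs⟩ : S) ∈ F → -s ∈ S' := by
    intro s hs
    induction hs using AddSubmonoid.closure_induction with
    | mem g hg =>
      intro hgF
      have hmem : (⟨g, hS (AddSubmonoid.subset_closure hg)⟩ : S) ∈ t' := by
        simpa [t'] using ⟨hg, hgF⟩
      have : -g = (∑ g ∈ t'.erase ⟨g, hS (AddSubmonoid.subset_closure hg)⟩, g : S).1 + -u.1 := by
        simp only [u]
        rw [← Finset.add_sum_erase _ _ hmem]
        simp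
      rw [this]
      exact add_mem (h (Subtype.prop _)) huS'
    | zero => intro _; simp
    | add a b ha hb iha ihb =>
      intro hab
      have := (hF ⟨a, hS ha⟩ ⟨b, hS hb⟩).1 hab
      simpa [add_comm] using add_mem (iha this.1) (ihb this.2)
  have hopen := IsOpenImmersion.of_isLocalization (S := AddMonoidAlgebra k S')
    (AddMonoidAlgebra.single u 1 : AddMonoidAlgebra k S)
  refine ⟨S', h, y', hopen, hy', ?_⟩
  intro s hs
  obtain ⟨a, ha, b, hb, hab⟩ := AddSubmonoid.mem_sup.1 s.2
  obtain ⟨n, rfl⟩ := AddSubmonoid.mem_closure_singleton.1 hb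
  have haF : (⟨a, ha⟩ : S) ∈ F := by
    intro hmem
    rw [← hy'] at hmem
    have hmem : (monoidAlgebraInclusion k h) (.single ⟨a, ha⟩ 1) ∈ y'.asIdeal := hmem
    have hmem' := y'.asIdeal.mul_mem_right (.single ⟨n • -u.1, nsmul_mem huS' n⟩ 1) hmem
    rw [monoidAlgebraInclusion_single, AddMonoidAlgebra.single_mul_single] at hmem'
    refine hs ?_
    convert hmem' using 2
    · ext1; simp [← hab]
    · simp
  rw [← hab]
  simpa [add_comm] using add_mem (hgen a (ht ▸ ha) haF) (nsmul_mem (h u.2) n)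

end MonoidAlgebra

/-! ### Affine charts of the projective toric variety -/

section Toric

attribute [local instance] MvPolynomial.gradedAlgebra

variable (k : Type u) [Field k] {r : ℕ} {P : Set (Fin r → ℤ)}

/-- The monoid generated by the differences `m' - m`, for `m' ∈ P`. -/
def differenceMonoid (P : Set (Fin r → ℤ)) (m : Fin r → ℤ) : AddSubmonoid (Fin r → ℤ) :=
  AddSubmonoid.closure ((fun m' => m' - m) '' P)

theorem X_mem_homogeneousSubmodule (m : P) :
    (MvPolynomial.X m : MvPolynomial P k) ∈ MvPolynomial.homogeneousSubmodule P k 1 :=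
  MvPolynomial.isHomogeneous_X k m

theorem isUnit_monomialAlgHom_X (m : P) :
    IsUnit ((monomialAlgHom k P).toRingHom (MvPolynomial.X m)) := by
  refine IsUnit.of_mul_eq_one (AddMonoidAlgebra.single (-m.1) 1) ?_
  simp [monomialAlgHom, AddMonoidAlgebra.single_mul_single, AddMonoidAlgebra.one_def]

/-- The extension of `monomialAlgHom` to Laurent polynomials in the variable `x_m`. -/
noncomputable def localizedMonomialHom (m : P) :
    Localization.Away (MvPolynomial.X m : MvPolynomial P k) →+* AddMonoidAlgebra k (Fin r → ℤ) :=
  IsLocalization.Away.lift (S := Localization.Away (MvPolynomial.X m : MvPolynomial P k)) _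
    (isUnit_monomialAlgHom_X k m)

theorem localizedMonomialHom_algebraMap (m : P) (a : MvPolynomial P k) :
    localizedMonomialHom k m (algebraMap _ _ a) = monomialAlgHom k P a :=
  IsLocalization.Away.lift_eq _ _ _

/-- The homomorphism sending the coordinate `x_{m'} / x_m` on `D₊(x_m)` to `t ^ (m' - m)`. -/
noncomputable def awayMonomialHom (m : P) :
    HomogeneousLocalization.Away (MvPolynomial.homogeneousSubmodule P k) (MvPolynomial.X m) →+*
      AddMonoidAlgebra k (Fin r → ℤ) :=
  (localizedMonomialHom k m).comp
    (algebraMap _ (Localization.Away (MvPolynomial.X m : MvPolynomial P k)))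

theorem awayMonomialHom_mk (m : P) (n : ℕ) (a : MvPolynomial P k)
    (ha : a ∈ MvPolynomial.homogeneousSubmodule P k (n • 1)) :
    awayMonomialHom k m (HomogeneousLocalization.Away.mk (MvPolynomial.homogeneousSubmodule P k)
      (X_mem_homogeneousSubmodule k m) n a ha) =
      monomialAlgHom k P a * AddMonoidAlgebra.single (-m.1) 1 ^ n := by
  have h1 : (AddMonoidAlgebra.single m.1 1 : AddMonoidAlgebra k (Fin r → ℤ)) *
      .single (-m.1) 1 = 1 := by
    simp [AddMonoidAlgebra.single_mul_single, AddMonoidAlgebra.one_def]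
  have h2 : monomialAlgHom k P (MvPolynomial.X m) = .single m.1 1 := by simp [monomialAlgHom]
  have h3 : awayMonomialHom k m (HomogeneousLocalization.Away.mk
      (MvPolynomial.homogeneousSubmodule P k) (X_mem_homogeneousSubmodule k m) n a ha) *
        monomialAlgHom k P (MvPolynomial.X m ^ n) = monomialAlgHom k P a := by
    rw [← localizedMonomialHom_algebraMap k m, ← localizedMonomialHom_algebraMap k m, awayMonomialHom,
      RingHom.comp_apply, ← map_mul, HomogeneousLocalization.algebraMap_apply,
      HomogeneousLocalization.Away.val_mk, Localization.mk_eq_mk']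
    exact congrArg _ (IsLocalization.mk'_spec _ a
      (⟨MvPolynomial.X m ^ n, n, rfl⟩ : Submonoid.powers (MvPolynomial.X m : MvPolynomial P k)))
  rw [← h3, map_pow, h2, _root_.mul_assoc, ← mul_pow, h1, one_pow, _root_.mul_one]

/-- A monomial of degree `n` divided by the `n`-th power of `x_m` is a product of `n` quotients
`x_{m'} / x_m`, so its image has exponent a sum of differences `m' - m`. -/
theorem range_awayMonomialHom (m : P) :
    (awayMonomialHom k m).range =
      (monoidAlgebraSubtype k (differenceMonoid P m.1)).toRingHom.range := by
  have hmem : ∀ j : P, j.1 - m.1 ∈ differenceMonoid P m.1 := fun j =>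
    AddSubmonoid.subset_closure ⟨j.1, j.2, rfl⟩
  refine le_antisymm ?_ ?_
  · rintro _ ⟨x, rfl⟩
    obtain ⟨n, a, ha, rfl⟩ := HomogeneousLocalization.Away.mk_surjective
      (MvPolynomial.homogeneousSubmodule P k) (X_mem_homogeneousSubmodule k m) x
    rw [awayMonomialHom_mk, a.as_sum, map_sum, Finset.sum_mul]
    refine sum_mem fun d hd => ?_
    have hn : n = ∑ j ∈ d.support, d j := by
      have : MvPolynomial.IsHomogeneous a (n • 1) := ha
      have := this (MvPolynomial.mem_support_iff.1 hd)
      simpa [Finsupp.weight_apply, Finsupp.sum] using this.symm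
    rw [monomialAlgHom, MvPolynomial.aeval_monomial, hn, ← Finset.prod_pow_eq_pow_sum,
      Finsupp.prod, _root_.mul_assoc, ← Finset.prod_mul_distrib]
    have hc : algebraMap k _ (a.coeff d) ∈
        (monoidAlgebraSubtype k (differenceMonoid P m.1)).toRingHom.range :=
      ⟨algebraMap k _ _, (monoidAlgebraSubtype k _).commutes _⟩
    refine mul_mem hc (prod_mem fun j _ => ?_)
    rw [← mul_pow]
    refine pow_mem (?_ : _ ∈ (monoidAlgebraSubtype k (differenceMonoid P m.1)).toRingHom.range) _
    refine ⟨.single ⟨_, hmem j⟩ 1, ?_⟩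
    change monoidAlgebraSubtype k _ _ = _
    rw [monoidAlgebraSubtype_single, AddMonoidAlgebra.single_mul_single]
    simp [sub_eq_add_neg]
  · rintro _ ⟨x, rfl⟩
    change monoidAlgebraSubtype k _ x ∈ _
    induction x using AddMonoidAlgebra.induction_linear with
    | zero => rw [map_zero]; exact zero_mem _
    | add x y hx hy => rw [map_add]; exact add_mem hx hy
    | single s c =>
      have hc : algebraMap k _ c ∈ (awayMonomialHom k m).range := by
        refine ⟨.mk _ (X_mem_homogeneousSubmodule k m) 0 (MvPolynomial.C c)
          (by simp), ?_⟩
        rw [awayMonomialHom_mk, pow_zero, _root_.mul_one]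
        exact (monomialAlgHom k P).commutes c
      have hs : ∀ s ∈ differenceMonoid P m.1,
          AddMonoidAlgebra.single s (1 : k) ∈ (awayMonomialHom k m).range := by
        intro s hs
        induction hs using AddSubmonoid.closure_induction with
        | mem g hg =>
          obtain ⟨j, hj, rfl⟩ := hg
          refine ⟨.mk _ (X_mem_homogeneousSubmodule k m) 1 (MvPolynomial.X ⟨j, hj⟩)
            (by simpa using X_mem_homogeneousSubmodule k _), ?_⟩
          rw [awayMonomialHom_mk, pow_one, monomialAlgHom, MvPolynomial.aeval_X,
            AddMonoidAlgebra.single_mul_single]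
          simp [sub_eq_add_neg]
        | zero => exact one_mem _
        | add a b _ _ ha hb =>
          have := mul_mem ha hb
          rwa [AddMonoidAlgebra.single_mul_single, _root_.mul_one] at this
      have := mul_mem hc (hs s.1 s.2)
      rw [monoidAlgebraSubtype_single]
      convert this using 1
      simp [AddMonoidAlgebra.single_mul_single]

/-- The projection from the coordinate ring of `D₊(x_m)` to that of the toric chart. -/
theorem exists_surjective_awayMonomialHom (m : P) :
    ∃ σ : HomogeneousLocalization.Away (MvPolynomial.homogeneousSubmodule P k)
        (MvPolynomial.X m) →+* AddMonoidAlgebra k (differenceMonoid P m.1),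
      Function.Surjective σ ∧
        (monoidAlgebraSubtype k (differenceMonoid P m.1)).toRingHom.comp σ =
          awayMonomialHom k m := by
  have hinj : Function.Injective (monoidAlgebraSubtype k (differenceMonoid P m.1)).toRingHom :=
    monoidAlgebraSubtype_injective _
  have h := range_awayMonomialHom k m
  choose σ hσ using fun x => (h ▸ ⟨x, rfl⟩ : awayMonomialHom k m x ∈
    (monoidAlgebraSubtype k (differenceMonoid P m.1)).toRingHom.range)
  refine ⟨{ toFun := σ
            map_one' := hinj (by rw [hσ]; simp)
            map_mul' := fun x y => hinj (by simp only [hσ, map_mul])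
            map_zero' := hinj (by rw [hσ]; simp)
            map_add' := fun x y => hinj (by simp only [hσ, map_add]) }, fun z => ?_,
    RingHom.ext hσ⟩
  obtain ⟨x, hx⟩ : (monoidAlgebraSubtype k _).toRingHom z ∈ (awayMonomialHom k m).range :=
    h ▸ ⟨z, rfl⟩
  exact ⟨x, hinj ((hσ x).trans hx)⟩

/-- The whole torus maps into the single chart `D₊(x_m)`, because `t^m` is invertible on it. -/
theorem monomialMap_eq (hP : P.Nonempty) (m : P) :
    monomialMap k hP = Spec.map (CommRingCat.ofHom (awayMonomialHom k m)) ≫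
      Proj.awayι (MvPolynomial.homogeneousSubmodule P k) (MvPolynomial.X m)
        (X_mem_homogeneousSubmodule k m) Nat.one_pos := by
  have hu : IsUnit (monomialHom k P (MvPolynomial.X m)) :=
    (isUnit_monomialAlgHom_X k m).map
      (Scheme.ΓSpecIso (.of (AddMonoidAlgebra k (Fin r → ℤ)))).inv.hom
  rw [monomialMap, Proj.fromOfGlobalSections_eq_awayι _ _ _ Nat.one_pos
    (X_mem_homogeneousSubmodule k m) hu]
  have : (IsLocalization.Away.lift (S := Localization.Away (MvPolynomial.X m : MvPolynomial P k))
        (MvPolynomial.X m) hu).comp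
        (algebraMap (HomogeneousLocalization.Away (MvPolynomial.homogeneousSubmodule P k)
          (MvPolynomial.X m)) (Localization.Away (MvPolynomial.X m : MvPolynomial P k))) =
      (Scheme.ΓSpecIso (.of (AddMonoidAlgebra k (Fin r → ℤ)))).inv.hom.comp
        (awayMonomialHom k m) := by
    rw [awayMonomialHom, ← RingHom.comp_assoc]
    congr 1
    refine IsLocalization.ringHom_ext (.powers (MvPolynomial.X m : MvPolynomial P k)) (RingHom.ext fun x => ?_)
    simp [monomialHom, localizedMonomialHom_algebraMap]
  rw [this]
  change _ ≫ Spec.map (CommRingCat.ofHom (awayMonomialHom k m) ≫ (Scheme.ΓSpecIso _).inv) ≫ _ = _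
  rw [Spec.map_comp, Category.assoc, toSpecΓ_SpecMap_ΓSpecIso_inv_assoc]

end Toric

theorem isSchemeTheoreticallyDominant_SpecMap {R S : CommRingCat.{u}} (f : R ⟶ S)
    (hf : Function.Injective f) : IsSchemeTheoreticallyDominant (Spec.map f) := by
  refine ⟨Scheme.IdealSheafData.ext_of_isAffine ?_⟩
  have : Function.Injective ((Spec.map f).appTop ≫ (Scheme.ΓSpecIso S).hom) := by
    rw [Scheme.ΓSpecIso_naturality]
    exact hf.comp (ConcreteCategory.bijective_of_isIso (Scheme.ΓSpecIso R).hom).1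
  have : Function.Injective (Spec.map f).appTop := Function.Injective.of_comp this
  rw [(Spec.map f).ker_apply ⟨⊤, isAffineOpen_top _⟩, Scheme.IdealSheafData.ideal_bot]
  exact (RingHom.injective_iff_ker_eq_bot _).1 this

section Toric

attribute [local instance] MvPolynomial.gradedAlgebra

variable (k : Type u) [Field k] {r : ℕ}

/-- The affine toric monoid scheme `Spec k[S]`. -/
noncomputable abbrev specMonoidAlgebra (S : AddSubmonoid (Fin r → ℤ)) : Over (Spec (.of k)) :=
  (Spec (.of (AddMonoidAlgebra k S))).asOver (Spec (.of k))

/-- The morphism from the torus to `Spec k[S]`. -/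
noncomputable def torusToSpec (S : AddSubmonoid (Fin r → ℤ)) :
    splitTorus k r ⟶ specMonoidAlgebra k S :=
  (Spec.map (CommRingCat.ofHom (monoidAlgebraSubtype k S).toRingHom)).asOver _

instance isSchemeTheoreticallyDominant_torusToSpec (S : AddSubmonoid (Fin r → ℤ)) :
    IsSchemeTheoreticallyDominant (torusToSpec k S).left :=
  isSchemeTheoreticallyDominant_SpecMap _ (monoidAlgebraSubtype_injective S)

instance (S : AddSubmonoid (Fin r → ℤ)) : QuasiCompact (torusToSpec k S).left :=
  inferInstanceAs (QuasiCompact (Spec.map _))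

variable {P : Set (Fin r → ℤ)}

instance (hP : P.Nonempty) : QuasiCompact (monomialMap k hP) := by
  have : QuasiCompact (monomialMap k hP ≫ Proj.toSpecZero _) :=
    quasiCompact_of_compactSpace _
  exact .of_comp _ (Proj.toSpecZero _)

instance (hP : P.Nonempty) : IsSchemeTheoreticallyDominant (torusToToric k hP).left :=
  isSchemeTheoreticallyDominant_toImage (monomialMap k hP)

instance (hP : P.Nonempty) : QuasiCompact (torusToToric k hP).left :=
  inferInstanceAs (QuasiCompact (monomialMap k hP).toImage)

theorem differenceMonoid_fg (hP : P.Finite) (m : Fin r → ℤ) : (differenceMonoid P m).FG :=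
  AddSubmonoid.fg_iff _ |>.2 ⟨_, rfl, hP.image _⟩

/-- The chart is closed in `D₊(x_m)` since its ring is a quotient of the coordinate ring there, and
the torus is dense in it since `k[S]` injects into the Laurent polynomials. So it is the part of the
closure of the torus in `D₊(x_m)`. -/
theorem exists_differenceMonoid_chart (hP : P.Nonempty) (m : P) :
    ∃ o : Spec (.of (AddMonoidAlgebra k (differenceMonoid P m.1))) ⟶ (monomialMap k hP).image,
      IsOpenImmersion o ∧
      Spec.map (CommRingCat.ofHom (monoidAlgebraSubtype k (differenceMonoid P m.1)).toRingHom) ≫ o =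
        (monomialMap k hP).toImage ∧
      Set.range o = (monomialMap k hP).imageι ⁻¹'
        (Proj.basicOpen (MvPolynomial.homogeneousSubmodule P k) (MvPolynomial.X m) : Set _) := by
  obtain ⟨σ, hσ, hcomp⟩ := exists_surjective_awayMonomialHom k m
  have : IsClosedImmersion (Spec.map (CommRingCat.ofHom σ)) :=
    .spec_of_surjective _ hσ
  have := isSchemeTheoreticallyDominant_SpecMap
    (CommRingCat.ofHom (monoidAlgebraSubtype k (differenceMonoid P m.1)).toRingHom)
    (monoidAlgebraSubtype_injective _)
  obtain ⟨o, h1, h2, -, h3⟩ := exists_isOpenImmersion_image (monomialMap k hP)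
    (Proj.awayι (MvPolynomial.homogeneousSubmodule P k) (MvPolynomial.X m)
        (X_mem_homogeneousSubmodule k m) Nat.one_pos) (Spec.map (CommRingCat.ofHom σ))
    (Spec.map (CommRingCat.ofHom (monoidAlgebraSubtype k (differenceMonoid P m.1)).toRingHom))
    (by rw [← Spec.map_comp_assoc, ← CommRingCat.ofHom_comp, hcomp, monomialMap_eq k hP m])
  refine ⟨o, h1, h2, ?_⟩
  rw [h3, ← Proj.opensRange_awayι _ _ (X_mem_homogeneousSubmodule k m) Nat.one_pos]
  rfl

theorem iSup_basicOpen_X :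
    ⨆ m : P, Proj.basicOpen (MvPolynomial.homogeneousSubmodule P k) (MvPolynomial.X m) = ⊤ := by
  refine Proj.iSup_basicOpen_eq_top' _ _ (fun m => ⟨1, X_mem_homogeneousSubmodule k m⟩) ?_
  rw [eq_top_iff]
  intro x _
  have hx : x ∈ Algebra.adjoin k (Set.range (MvPolynomial.X : P → MvPolynomial P k)) := by
    rw [MvPolynomial.adjoin_range_X]; trivial
  induction hx using Algebra.adjoin_induction with
  | mem x hx => exact Algebra.subset_adjoin hx
  | algebraMap c =>
    exact Subalgebra.algebraMap_mem _ (algebraMap k (MvPolynomial.homogeneousSubmodule P k 0) c)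
  | add x y _ _ hx hy => exact add_mem (hx trivial) (hy trivial)
  | mul x y _ _ hx hy => exact mul_mem (hx trivial) (hy trivial)

/-- Every point of the toric variety lies on the closed torus orbit of an affine toric chart. -/
theorem exists_toric_chart (hP : P.Nonempty) (hfin : P.Finite) (g : (toricVariety k hP).left) :
    ∃ (S : AddSubmonoid (Fin r → ℤ)) (o : specMonoidAlgebra k S ⟶ toricVariety k hP)
      (y : PrimeSpectrum (AddMonoidAlgebra k S)),
      IsOpenImmersion o.left ∧ torusToSpec k S ≫ o = torusToToric k hP ∧ o.left y = g ∧
        ∀ s : S, .single s 1 ∉ y.asIdeal → -s.1 ∈ S := by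
  obtain ⟨m, hm⟩ := TopologicalSpace.Opens.mem_iSup.1
    ((iSup_basicOpen_X k (P := P)).ge (Set.mem_univ ((monomialMap k hP).imageι g)))
  obtain ⟨o, h1, h2, h3⟩ := exists_differenceMonoid_chart k hP m
  obtain ⟨y, hy⟩ : g ∈ Set.range o := by rw [h3]; exact hm
  -- Discarding the zero locus of a monomial that does not vanish at `g` puts `g` on the closed
  -- orbit of the smaller chart.
  obtain ⟨S', h, y', h4, h5, h6⟩ := exists_localization_monomials (differenceMonoid_fg hfin m.1) y
  let o' : Spec (.of (AddMonoidAlgebra k S')) ⟶ (monomialMap k hP).image :=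
    Spec.map (CommRingCat.ofHom (monoidAlgebraInclusion k h).toRingHom) ≫ o
  have h7 : Spec.map (CommRingCat.ofHom (monoidAlgebraSubtype k S').toRingHom) ≫ o' =
        (monomialMap k hP).toImage := by
    rw [← h2, ← Spec.map_comp_assoc, ← CommRingCat.ofHom_comp,
      ← monoidAlgebraSubtype_comp_inclusion h]
    rfl
  have h8 : IsOpenImmersion o' := inferInstance
  have hdom := isSchemeTheoreticallyDominant_SpecMap
    (CommRingCat.ofHom (monoidAlgebraSubtype k S').toRingHom) (monoidAlgebraSubtype_injective S')
  have h9 : o' ≫ (toricVariety k hP).hom = (specMonoidAlgebra k S').hom := by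
    refine IsSchemeTheoreticallyDominant.hom_ext
      (Spec.map (CommRingCat.ofHom (monoidAlgebraSubtype k S').toRingHom)) (terminal.from _)
      (Subsingleton.elim _ _) ?_
    refine Eq.trans ?_ ((Over.w (torusToToric k hP)).trans (Over.w (torusToSpec k S')).symm)
    exact (Category.assoc _ _ _).symm.trans congr($h7 ≫ (toricVariety k hP).hom)
  refine ⟨S', Over.homMk (U := specMonoidAlgebra k S') o' h9, y', h8, ?_, ?_, h6⟩
  · ext1
    exact h7
  · rw [← hy, ← h5]
    rfl

end Toric

/-! ### The idempotent of an affine toric monoid and its torus orbit -/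

section Monoid
variable (k : Type u) [Field k] {r : ℕ}

instance isMonHom_torusToSpec (S : AddSubmonoid (Fin r → ℤ)) : IsMonHom (torusToSpec k S) :=
  inferInstanceAs (IsMonHom ((bialgSpec (.of k)).map (.op (CommBialgCat.ofHom
    (AddMonoidAlgebra.mapDomainBialgHom k S.subtype)))).hom)


open Classical in
/-- The indicator function of the invertible elements of a submonoid of a lattice. -/
noncomputable def unitIndicator (S : AddSubmonoid (Fin r → ℤ)) : Multiplicative S →* k where
  toFun s := if -s.toAdd.1 ∈ S then 1 else 0
  map_one' := by simp
  map_mul' a b := by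
    -- A sum is invertible in `S` exactly when both summands are; hence the indicator is
    -- multiplicative.
    have h : -(a * b).toAdd.1 ∈ S ↔ -a.toAdd.1 ∈ S ∧ -b.toAdd.1 ∈ S := by
      rw [toAdd_mul, AddSubmonoid.coe_add, neg_add]
      refine ⟨fun h => ⟨?_, ?_⟩, fun h => add_mem h.1 h.2⟩
      · simpa using add_mem h b.toAdd.2
      · simpa using add_mem h a.toAdd.2
    rw [if_congr h rfl rfl]
    by_cases ha : -a.toAdd.1 ∈ S <;> by_cases hb : -b.toAdd.1 ∈ S <;> simp [ha, hb]

/-- The distinguished point of the closed torus orbit of `Spec k[S]`. -/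
noncomputable def distinguishedPoint (S : AddSubmonoid (Fin r → ℤ)) :
    𝟙_ (Over (Spec (.of k))) ⟶ specMonoidAlgebra k S :=
  Over.homMk (Spec.map (CommRingCat.ofHom
    (AddMonoidAlgebra.lift k k S (unitIndicator k S)).toRingHom)) (by
      change Spec.map _ ≫ Spec.map _ = 𝟙 _
      rw [← Spec.map_comp, ← CommRingCat.ofHom_comp, ← Spec.map_id]
      congr 2
      exact RingHom.ext (AddMonoidAlgebra.lift k k S (unitIndicator k S)).commutes)

variable {k}

theorem toUnit_comp_distinguishedPoint (S : AddSubmonoid (Fin r → ℤ)) (T : Type u) [CommRing T]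
    [Algebra k T] :
    toUnit ((Spec (.of T)).asOver (Spec (.of k))) ≫ distinguishedPoint k S =
      Spec.mapMulEquiv (.toConv ((Algebra.ofId k T).comp
        (AddMonoidAlgebra.lift k k S (unitIndicator k S)))) := by
  ext1
  change Spec.map _ ≫ Spec.map _ = Spec.map _
  rw [← Spec.map_comp, ← CommRingCat.ofHom_comp]
  rfl

/-- A `T`-valued point of `Spec k[S]` is a character of `S` with values in `T`, and points multiply
as characters do. -/
theorem mapMulEquiv_lift_mul (S : AddSubmonoid (Fin r → ℤ)) (T : Type u) [CommRing T]
    [Algebra k T] (F : Multiplicative S →* T) :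
    (Spec.mapMulEquiv (.toConv (AddMonoidAlgebra.lift k T S F)) :
        (Spec (.of T)).asOver (Spec (.of k)) ⟶ specMonoidAlgebra k S) *
      (toUnit _ ≫ distinguishedPoint k S) =
    Spec.mapMulEquiv (.toConv (AddMonoidAlgebra.lift k T S
      (F * (algebraMap k T : k →* T).comp (unitIndicator k S)))) := by
  rw [toUnit_comp_distinguishedPoint, ← map_mul]
  congr 1
  have h : (Algebra.ofId k T).comp (AddMonoidAlgebra.lift k k S (unitIndicator k S)) =
      AddMonoidAlgebra.lift k T S ((algebraMap k T : k →* T).comp (unitIndicator k S)) := by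
    ext s
    simp [Algebra.ofId_apply]
  rw [h]
  exact (map_mul (AddMonoidAlgebra.liftMulEquiv (R := k) (A := T) (M := S)) F _).symm

/-- The indicator takes only the values 0 and 1, so it equals its square. -/
theorem distinguishedPoint_mul_self (S : AddSubmonoid (Fin r → ℤ)) :
    distinguishedPoint k S * distinguishedPoint k S = distinguishedPoint k S := by
  have : IsIso (toUnit ((Spec (.of k)).asOver (Spec (.of k)))).left := by
    change IsIso (Spec.map (𝟙 _)); infer_instance
  have : IsIso (toUnit ((Spec (.of k)).asOver (Spec (.of k)))) :=
    @isIso_of_reflects_iso _ _ _ _ _ _ _ (Over.forget _) this _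
  rw [← cancel_epi (toUnit ((Spec (.of k)).asOver (Spec (.of k)))), MonObj.comp_mul]
  have h : toUnit ((Spec (.of k)).asOver (Spec (.of k))) ≫ distinguishedPoint k S =
      Spec.mapMulEquiv (.toConv (AddMonoidAlgebra.lift k k S (unitIndicator k S))) := by
    rw [toUnit_comp_distinguishedPoint]
    congr 2
  refine (congrArg (· * _) h).trans ((mapMulEquiv_lift_mul _ _ _).trans (Eq.trans ?_ h.symm))
  congr 3
  ext s
  simp [unitIndicator]

theorem torusToSpec_mul_distinguishedPoint (S : AddSubmonoid (Fin r → ℤ)) :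
    torusToSpec k S * (toUnit _ ≫ distinguishedPoint k S) =
      Spec.mapMulEquiv (.toConv (AddMonoidAlgebra.lift k _ S
        ((AddMonoidAlgebra.of k (Fin r → ℤ)).comp S.subtype.toMultiplicative *
          (algebraMap k (AddMonoidAlgebra k (Fin r → ℤ)) : k →* _).comp (unitIndicator k S)))) := by
  rw [← mapMulEquiv_lift_mul]
  congr 1
  change Spec.mapMulEquiv (.toConv (monoidAlgebraSubtype k S)) = _
  congr 2
  ext s
  simp

theorem id_mul_distinguishedPoint (S : AddSubmonoid (Fin r → ℤ)) :
    𝟙 (specMonoidAlgebra k S) * (toUnit _ ≫ distinguishedPoint k S) =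
      Spec.mapMulEquiv (.toConv (AddMonoidAlgebra.lift k _ S
        (AddMonoidAlgebra.of k S *
          (algebraMap k (AddMonoidAlgebra k S) : k →* _).comp (unitIndicator k S)))) := by
  rw [← mapMulEquiv_lift_mul]
  congr 1
  have h : AddMonoidAlgebra.lift k _ S (AddMonoidAlgebra.of k S) = AlgHom.id k _ := by
    ext s
    simp
  rw [h]
  ext1
  exact (Spec.map_id _).symm

-- The prime `y` is shown to be the contraction of its extension along `F`. The linear map `ρ` keeps
-- the terms with exponent in `S ∩ -S`. It satisfies `ρ 1 = 1` and `ρ (F a * x) ≡ a * ρ x` modulo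
-- `y`, since the monomials killed by `F` lie in `y` by `hy`. So `ρ` carries the extension of `y`
-- into `y`, and `F a` in the extension gives `a ∈ y`.
open Classical in
theorem mem_range_comap_of_units (S : AddSubmonoid (Fin r → ℤ))
    (y : PrimeSpectrum (AddMonoidAlgebra k S)) (hy : ∀ s : S, .single s 1 ∉ y.asIdeal → -s.1 ∈ S)
    (F : AddMonoidAlgebra k S →+* AddMonoidAlgebra k (Fin r → ℤ))
    (hF : ∀ s c, F (.single s c) = if -s.1 ∈ S then .single s.1 c else 0) :
    y ∈ Set.range (PrimeSpectrum.comap F) := by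
  let b := AddMonoidAlgebra.basis (Fin r → ℤ) k
  let ρ : AddMonoidAlgebra k (Fin r → ℤ) →ₗ[k] AddMonoidAlgebra k S :=
    b.constr k fun n => if h : n ∈ S ∧ -n ∈ S then .single ⟨n, h.1⟩ 1 else 0
  have hρ (n : Fin r → ℤ) : ρ (.single n 1) = if h : n ∈ S ∧ -n ∈ S then .single ⟨n, h.1⟩ 1 else 0 :=
    b.constr_basis k _ n
  have hρ' (n : Fin r → ℤ) (d : k) :
      ρ (.single n d) = if h : n ∈ S ∧ -n ∈ S then .single ⟨n, h.1⟩ d else 0 := by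
    have := congr(d • $(hρ n))
    rw [← map_smul] at this
    by_cases hn : n ∈ S ∧ -n ∈ S <;> simpa [hn] using this
  have hmul (a : AddMonoidAlgebra k S) (x : AddMonoidAlgebra k (Fin r → ℤ)) :
      ρ (F a * x) - a * ρ x ∈ y.asIdeal := by
    induction a using AddMonoidAlgebra.induction_linear with
    | zero => simp
    | add a a' h h' =>
      have := add_mem h h'
      rwa [map_add, add_mul, add_mul, map_add, add_sub_add_comm]
    | single s c =>
    induction x using AddMonoidAlgebra.induction_linear with
    | zero => simp
    | add x x' h h' =>
      have := add_mem h h'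
      rwa [mul_add, map_add, map_add, mul_add, add_sub_add_comm]
    | single n d =>
    rw [hF, hρ']
    by_cases hs : -s.1 ∈ S
    · rw [if_pos hs, AddMonoidAlgebra.single_mul_single, hρ']
      have h : (s.1 + n ∈ S ∧ -(s.1 + n) ∈ S) ↔ n ∈ S ∧ -n ∈ S := by
        rw [neg_add]
        refine ⟨fun h => ⟨?_, ?_⟩, fun h => ⟨add_mem s.2 h.1, add_mem hs h.2⟩⟩
        · simpa using add_mem hs h.1
        · simpa using add_mem s.2 h.2
      by_cases hn : n ∈ S ∧ -n ∈ S
      · rw [dif_pos hn, dif_pos (h.2 hn), AddMonoidAlgebra.single_mul_single, sub_eq_zero.2]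
        · exact y.asIdeal.zero_mem
        · rfl
      · rw [dif_neg hn, dif_neg (mt h.1 hn)]
        simp
    · rw [if_neg hs, zero_mul, map_zero, zero_sub, neg_mem_iff]
      refine y.asIdeal.mul_mem_right _ ?_
      have := y.asIdeal.mul_mem_left (.single 0 c) (not_not.1 (mt (hy s) hs))
      simpa [AddMonoidAlgebra.single_mul_single] using this
  rw [PrimeSpectrum.mem_range_comap_iff]
  refine le_antisymm (fun a ha => ?_) Ideal.le_comap_map
  have key : ∀ x ∈ y.asIdeal.map F, ρ x ∈ y.asIdeal := by
    intro x hx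
    suffices h : ∀ c, ρ (x * c) ∈ y.asIdeal by simpa using h 1
    refine Submodule.span_induction (p := fun x _ => ∀ c, ρ (x * c) ∈ y.asIdeal) ?_ ?_ ?_ ?_ hx
    · rintro _ ⟨a, ha, rfl⟩ c
      simpa using add_mem (hmul a c) (y.asIdeal.mul_mem_right (ρ c) ha)
    · simp
    · intro x x' _ _ h h' c
      rw [add_mul, map_add]
      exact add_mem (h c) (h' c)
    · intro d x _ h c
      rw [smul_eq_mul, _root_.mul_comm d, _root_.mul_assoc]
      exact h _
  have h1 : ρ 1 = 1 := by simp [AddMonoidAlgebra.one_def, hρ]; rfl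
  have := sub_mem (key _ ha) (hmul a 1)
  simpa [h1] using this

theorem mem_range_torusToSpec_mul (S : AddSubmonoid (Fin r → ℤ))
    (y : PrimeSpectrum (AddMonoidAlgebra k S)) (hy : ∀ s : S, .single s 1 ∉ y.asIdeal → -s.1 ∈ S) :
    y ∈ Set.range (torusToSpec k S * (toUnit _ ≫ distinguishedPoint k S)).left := by
  rw [torusToSpec_mul_distinguishedPoint]
  refine mem_range_comap_of_units S y hy (AddMonoidAlgebra.lift k _ S _).toRingHom fun s c => ?_
  by_cases hs : -s.1 ∈ S <;>
    simp [unitIndicator, hs, AddMonoidAlgebra.lift_single, AddMonoidAlgebra.of_apply]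

/-- Every non-invertible monomial vanishes at a point of the form `w w₀`, so
`mem_range_torusToSpec_mul` applies. -/
theorem range_id_mul_subset (S : AddSubmonoid (Fin r → ℤ)) :
    Set.range (𝟙 (specMonoidAlgebra k S) * (toUnit _ ≫ distinguishedPoint k S)).left ⊆
      Set.range (torusToSpec k S * (toUnit _ ≫ distinguishedPoint k S)).left := by
  rintro _ ⟨y, rfl⟩
  refine mem_range_torusToSpec_mul S _ fun s hs => ?_
  rw [id_mul_distinguishedPoint] at hs
  by_contra h
  refine hs ?_
  change AddMonoidAlgebra.lift k _ S _ (.single s 1) ∈ PrimeSpectrum.asIdeal y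
  simp [unitIndicator, h, AddMonoidAlgebra.lift_single]

end Monoid

/-! ### Gluing and descent along maps with local sections -/

section Gluing

variable {S : Scheme.{u}}

/-- The open cover of `X` given by a jointly surjective family of open immersions over `S`. -/
noncomputable def Over.openCoverOfRange {X : Over S} {I : Type u} {C : I → Over S}
    (f : ∀ x, C x ⟶ X) (hf : ∀ x, IsOpenImmersion (f x).left)
    (hcov : ∀ z : X.left, ∃ x, z ∈ Set.range (f x).left) : X.left.OpenCover where
  I₀ := I
  X x := (C x).left
  f x := (f x).left
  mem₀ := by
    rw [Scheme.presieve₀_mem_precoverage_iff]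
    exact ⟨fun z => hcov z, hf⟩

theorem Over.hom_ext_of_cover {X Y : Over S} {I : Type u} {C : I → Over S} (f : ∀ x, C x ⟶ X)
    (hf : ∀ x, IsOpenImmersion (f x).left) (hcov : ∀ z : X.left, ∃ x, z ∈ Set.range (f x).left)
    {g h : X ⟶ Y} (H : ∀ x, f x ≫ g = f x ≫ h) : g = h := by
  let 𝒰 : X.left.OpenCover := Over.openCoverOfRange f hf hcov
  ext1
  exact 𝒰.hom_ext _ _ fun x => congr($(H x).left)

theorem Over.exists_glue {X Y : Over S} {I : Type u} {C : I → Over S} (f : ∀ x, C x ⟶ X)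
    (hf : ∀ x, IsOpenImmersion (f x).left) (hcov : ∀ z : X.left, ∃ x, z ∈ Set.range (f x).left)
    (g : ∀ x, C x ⟶ Y)
    (H : ∀ (x y : I) (Z : Over S) (a : Z ⟶ C x) (b : Z ⟶ C y), a ≫ f x = b ≫ f y →
      a ≫ g x = b ≫ g y) : ∃ h : X ⟶ Y, ∀ x, f x ≫ h = g x := by
  let 𝒰 : X.left.OpenCover := Over.openCoverOfRange f hf hcov
  have hglue (x y : I) : pullback.fst (𝒰.f x) (𝒰.f y) ≫ (g x).left =
      pullback.snd (𝒰.f x) (𝒰.f y) ≫ (g y).left := by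
    let a : Over.mk (pullback.fst (𝒰.f x) (𝒰.f y) ≫ (C x).hom) ⟶ C x :=
      Over.homMk (pullback.fst (𝒰.f x) (𝒰.f y))
    let b : Over.mk (pullback.fst (𝒰.f x) (𝒰.f y) ≫ (C x).hom) ⟶ C y :=
      Over.homMk (pullback.snd (𝒰.f x) (𝒰.f y)) (by
        change pullback.snd (𝒰.f x) (𝒰.f y) ≫ (C y).hom = pullback.fst (𝒰.f x) (𝒰.f y) ≫ (C x).hom
        rw [← Over.w (f x), ← Over.w (f y)]
        exact (pullback.condition_assoc _).symm)
    exact congr($(H x y _ a b (by ext1; exact pullback.condition)).left)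
  obtain ⟨h, hh⟩ : ∃ h : X.left ⟶ Y.left, ∀ x : I, (f x).left ≫ h = (g x).left :=
    ⟨𝒰.glueMorphisms (fun x => (g x).left) hglue, 𝒰.ι_glueMorphisms _ hglue⟩
  refine ⟨Over.homMk h (𝒰.hom_ext _ _ fun x => ?_), fun x => Over.OverMorphism.ext (hh x)⟩
  exact (Category.assoc _ _ _).symm.trans (congr($(hh x) ≫ Y.hom).trans
    ((Over.w (g x)).trans (Over.w (f x)).symm))

end Gluing

section Over

variable {k : Type u} [Field k]

/-- A morphism to `X` with image in an open subset factors through that open subset. -/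
theorem exists_lift_openSub {X Z : Over (Spec (.of k))} (U : X.left.Opens) (f : Z ⟶ X)
    (h : Set.range f.left ⊆ U) : ∃ f' : Z ⟶ openSub U, f' ≫ openSubι U = f := by
  have h' : Set.range f.left ⊆ Set.range U.ι := by simpa using h
  refine ⟨Over.homMk (IsOpenImmersion.lift U.ι f.left h') ?_, ?_⟩
  · simp
  · ext1
    simp

theorem range_left_comp_subset {X Y Z : Over (Spec (.of k))} (f : X ⟶ Y) (g : Y ⟶ Z) :
    Set.range (f ≫ g).left ⊆ Set.range g.left := by
  rintro _ ⟨x, rfl⟩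
  exact ⟨f.left x, rfl⟩

theorem mono_of_left {X Y : Over (Spec (.of k))} (f : X ⟶ Y) (h : Mono f.left) : Mono f :=
  @Functor.mono_of_mono_map _ _ _ _ (Over.forget _) _ _ _ f h

/-- A morphism from a reduced scheme factors through an immersion as soon as it does so on
points. -/
theorem exists_lift_immersion {X Y T : Over (Spec (.of k))} (i : T ⟶ X) (hi : IsImmersion i.left)
    (hY : IsReduced Y.left) (f : Y ⟶ X) (h : Set.range f.left ⊆ Set.range i.left) :
    ∃ f' : Y ⟶ T, f' ≫ i = f := by
  -- The base change of `i` is an immersion with full image, thus a surjective closed immersion into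
  -- a reduced scheme, which is an isomorphism.
  have hs : Function.Surjective (pullback.fst f.left i.left) := by
    intro y
    obtain ⟨t, ht⟩ := h ⟨y, rfl⟩
    obtain ⟨z, hz, -⟩ := Scheme.Pullback.exists_preimage_pullback y t ht.symm
    exact ⟨z, hz⟩
  have : Surjective (pullback.fst f.left i.left) := ⟨hs⟩
  have : IsClosedImmersion (pullback.fst f.left i.left) :=
    .of_isPreimmersion _ (by rw [hs.range_eq]; exact isClosed_univ)
  have := isIso_of_isClosedImmersion_of_surjective (pullback.fst f.left i.left)
  have h1 : (inv (pullback.fst f.left i.left) ≫ pullback.snd f.left i.left) ≫ i.left = f.left := by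
    rw [Category.assoc, ← pullback.condition, IsIso.inv_hom_id_assoc]
  refine ⟨Over.homMk (inv (pullback.fst f.left i.left) ≫ pullback.snd f.left i.left) ?_, ?_⟩
  · rw [← Over.w i, ← Category.assoc, h1, Over.w f]
  · ext1
    exact h1

/-- A morphism `q` to `X` that has sections over the members of an open cover of its image
factors through its image `U`, universally epimorphically, and morphisms descend along `q`. -/
theorem exists_open_range_of_local_sections {B X : Over (Spec (.of k))} (q : B ⟶ X) {I : Type u}
    {C : I → Over (Spec (.of k))} (σ : ∀ x, C x ⟶ B)
    (hσ : ∀ x, IsOpenImmersion (σ x ≫ q).left)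
    (hcov : ∀ z ∈ Set.range q.left, ∃ x, z ∈ Set.range (σ x ≫ q).left) :
    ∃ (U : X.left.Opens) (q' : B ⟶ openSub U), (U : Set X.left) = Set.range q.left ∧
      q' ≫ openSubι U = q ∧
      (∀ (Y Z : Over (Spec (.of k))) (g h : Y ⊗ openSub U ⟶ Z),
        (Y ◁ q') ≫ g = (Y ◁ q') ≫ h → g = h) ∧
      ∀ (Z : Over (Spec (.of k))) (f : B ⟶ Z),
        (∀ (Y : Over (Spec (.of k))) (a b : Y ⟶ B), a ≫ q = b ≫ q → a ≫ f = b ≫ f) →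
        ∃ p : openSub U ⟶ Z, q' ≫ p = f := by
  have hrange : (⋃ x, Set.range (σ x ≫ q).left) = Set.range q.left := by
    refine subset_antisymm (Set.iUnion_subset fun x => range_left_comp_subset _ _) fun z hz => ?_
    exact Set.mem_iUnion.2 (hcov z hz)
  let U : X.left.Opens := ⟨Set.range q.left, by
    rw [← hrange]
    exact isOpen_iUnion fun x => (σ x ≫ q).left.isOpenEmbedding.isOpen_range⟩
  obtain ⟨q', hq'⟩ := exists_lift_openSub U q subset_rfl
  have hmono : Mono (openSubι U) := mono_of_left _ (inferInstanceAs (Mono U.ι))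
  have hopen (x : I) : IsOpenImmersion (σ x ≫ q').left := by
    have : IsOpenImmersion ((σ x ≫ q').left ≫ U.ι) := by
      have h := hσ x
      rw [← hq'] at h
      simpa using h
    exact .of_comp _ U.ι
  have hcov' (z : (openSub U).left) : ∃ x, z ∈ Set.range (σ x ≫ q').left := by
    obtain ⟨x, c, hc⟩ := hcov (U.ι z) z.2
    refine ⟨x, c, U.ι.isOpenEmbedding.injective ?_⟩
    rw [← hc, ← hq']
    rfl
  refine ⟨U, q', rfl, hq', fun Y Z g h H => ?_, fun Z f H => ?_⟩
  · refine Over.hom_ext_of_cover (fun x => Y ◁ (σ x ≫ q')) (fun x => ?_) (fun z => ?_) (fun x => ?_)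
    · exact MorphismProperty.of_isPullback (isPullback_whiskerLeft_snd_left Y (σ x ≫ q')).flip
        (hopen x)
    · obtain ⟨x, c, hc⟩ := hcov' ((snd Y (openSub U)).left z)
      obtain ⟨z', hz', -⟩ := exists_whiskerLeft_eq Y (σ x ≫ q') z c hc.symm
      exact ⟨x, z', hz'⟩
    · simp [H]
  -- On the chart `C x` the descended map is `σ x ≫ f`. Agreement on overlaps, and `q' ≫ p = f` on
  -- the preimages of the charts, both hold because `f` identifies generalized points with the same
  -- image under `q`.
  · obtain ⟨p, hp⟩ := Over.exists_glue (fun x => σ x ≫ q') hopen hcov' (fun x => σ x ≫ f)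
      (fun x y T a b h => by
        have := H T (a ≫ σ x) (b ≫ σ y) (by
          simpa [hq'] using congr($h ≫ openSubι U))
        simpa using this)
    refine ⟨p, ?_⟩
    refine Over.hom_ext_of_cover
      (C := fun x => Over.mk (pullback.snd (σ x ≫ q').left q'.left ≫ B.hom))
      (fun x => Over.homMk (pullback.snd (σ x ≫ q').left q'.left)) (fun x => ?_) (fun z => ?_)
      (fun x => ?_)
    · exact inferInstanceAs (IsOpenImmersion (pullback.snd (σ x ≫ q').left q'.left))
    · obtain ⟨x, c, hc⟩ := hcov' (q'.left z)
      obtain ⟨w, -, hw⟩ := Scheme.Pullback.exists_preimage_pullback c z hc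
      exact ⟨x, w, hw⟩
    · let b : Over.mk (pullback.snd (σ x ≫ q').left q'.left ≫ B.hom) ⟶ B :=
        Over.homMk (pullback.snd (σ x ≫ q').left q'.left)
      let a : Over.mk (pullback.snd (σ x ≫ q').left q'.left ≫ B.hom) ⟶ C x :=
        Over.homMk (pullback.fst (σ x ≫ q').left q'.left) (by
          have h := pullback.condition_assoc (f := (σ x ≫ q').left) (g := q'.left) (openSub U).hom
          rw [Over.w, Over.w] at h
          exact h)
      have hab : a ≫ σ x ≫ q' = b ≫ q' := by
        ext1
        exact pullback.condition
      change b ≫ q' ≫ p = b ≫ f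
      rw [← reassoc_of% hab]
      have h2 := hp x
      rw [Category.assoc] at h2
      rw [h2, ← Category.assoc]
      refine H _ _ _ ?_
      rw [← hq', Category.assoc, reassoc_of% hab]

end Over

/-! ### The contracted product of the group with the fibre -/

section Fibre

variable {C : Type*} [Category* C] [CartesianMonoidalCategory C]
variable {A A₀ N W X : C} [GrpObj A] [GrpObj A₀] [MonObj W]

/-- `c : W ⟶ X` is an embedding into the fibre at the origin of `ρbar : X ⟶ A₀` which is
equivariant for the kernel `κ : N ⟶ A` of `ρ`, where `N` acts on the monoid `W` by
translations through `ε : N ⟶ W`. -/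
structure IsEquivariantFibre (κ : N ⟶ A) (ρ : A ⟶ A₀) (act : A ⊗ X ⟶ X) (ρbar : X ⟶ A₀)
    (ε : N ⟶ W) (c : W ⟶ X) : Prop where
  isGroupAction : IsGroupAction act
  isMonHom : IsMonHom ρ
  kernel : IsPullback κ (toUnit N) ρ η[A₀]
  act_comp : ∀ {Z : C} (a : Z ⟶ A) (x : Z ⟶ X),
    lift a x ≫ act ≫ ρbar = (a ≫ ρ) * (x ≫ ρbar)
  comp : c ≫ ρbar = 1
  mono : Mono c
  equivariant : ∀ {Z : C} (t : Z ⟶ N) (w : Z ⟶ W),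
    lift (t ≫ κ) (w ≫ c) ≫ act = ((t ≫ ε) * w) ≫ c

variable {κ : N ⟶ A} {ρ : A ⟶ A₀} {act : A ⊗ X ⟶ X} {ρbar : X ⟶ A₀} {ε : N ⟶ W} {c : W ⟶ X}

namespace IsEquivariantFibre

/-- This is the relation that defines the contracted product of `A` and `W` over `N`. -/
theorem lift_mul_comp (hF : IsEquivariantFibre κ ρ act ρbar ε c) {Z : C}
    (a : Z ⟶ A) (t : Z ⟶ N) (w : Z ⟶ W) :
    lift (a * (t ≫ κ)) w ≫ (A ◁ c) ≫ act = lift a ((t ≫ ε) * w) ≫ (A ◁ c) ≫ act := by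
  rw [lift_whiskerLeft_assoc, lift_whiskerLeft_assoc, hF.isGroupAction.mul_act, hF.equivariant]

theorem exists_kernel_lift (hF : IsEquivariantFibre κ ρ act ρbar ε c) {Z : C}
    (a b : Z ⟶ A) (h : a ≫ ρ = b ≫ ρ) :
    ∃ t : Z ⟶ N, b * (t ≫ κ) = a := by
  have := hF.isMonHom
  have h1 : (b⁻¹ * a) ≫ ρ = toUnit Z ≫ η[A₀] := by
    rw [MonObj.mul_comp, GrpObj.inv_comp, h, inv_mul_cancel]
    rfl
  exact ⟨hF.kernel.lift _ _ h1, by rw [hF.kernel.lift_fst, mul_inv_cancel_left]⟩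

/-- Comparing images in `A₀` gives `a = b κ(t)`, and then `ε(t) w = z` because `c` is a
monomorphism. Multiplication by `u` on the right preserves this relation, which is why right
translations of `W` descend. -/
theorem comp_eq_of_comp_eq (hF : IsEquivariantFibre κ ρ act ρbar ε c) {Z : C}
    (a b : Z ⟶ A) (w z u : Z ⟶ W)
    (h : lift a w ≫ (A ◁ c) ≫ act = lift b z ≫ (A ◁ c) ≫ act) :
    lift a (w * u) ≫ (A ◁ c) ≫ act = lift b (z * u) ≫ (A ◁ c) ≫ act := by
  have hρ (a : Z ⟶ A) (w : Z ⟶ W) : (lift a w ≫ (A ◁ c) ≫ act) ≫ ρbar = a ≫ ρ := by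
    rw [Category.assoc, Category.assoc, lift_whiskerLeft_assoc, hF.act_comp, Category.assoc,
      hF.comp, MonObj.comp_one, _root_.mul_one]
  obtain ⟨t, rfl⟩ := hF.exists_kernel_lift a b (by rw [← hρ a w, ← hρ b z, h])
  rw [hF.lift_mul_comp] at h ⊢
  have h1 : ((t ≫ ε) * w) ≫ c = z ≫ c := by
    rw [← hF.isGroupAction.inv_act b (z ≫ c), ← lift_whiskerLeft_assoc b, ← h,
      lift_whiskerLeft_assoc, hF.isGroupAction.inv_act]
  have := hF.mono
  rw [cancel_mono] at h1
  rw [← _root_.mul_assoc, h1]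

end IsEquivariantFibre

end Fibre

/-! ### Orbits of rational points -/

section Orbit

variable {k : Type u} [Field k]

theorem IsOrbit.act_mem_range {G X T : Over (Spec (.of k))} {act : G ⊗ X ⟶ X} {i : T ⟶ X}
    (hT : IsOrbit act i) (z : (G ⊗ X).left) (hz : (snd G X).left z ∈ Set.range i.left) :
    act.left z ∈ Set.range i.left := by
  obtain ⟨t, ht⟩ := hz
  obtain ⟨actT, hact, -⟩ := hT.transitive
  obtain ⟨z', rfl, -⟩ := exists_whiskerLeft_eq G i z t ht.symm
  refine ⟨actT.left z', ?_⟩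
  rw [← Scheme.Hom.comp_apply, ← Scheme.Hom.comp_apply, ← Over.comp_left, ← Over.comp_left, hact]

theorem left_toUnit_comp_eq {X Z : Over (Spec (.of k))} (x : 𝟙_ (Over (Spec (.of k))) ⟶ X)
    (z z' : Z.left) : (toUnit Z ≫ x).left z = (toUnit Z ≫ x).left z' := by
  have : Subsingleton (𝟙_ (Over (Spec (.of k)))).left :=
    inferInstanceAs (Subsingleton (PrimeSpectrum k))
  exact congrArg x.left (Subsingleton.elim ((toUnit Z).left z) ((toUnit Z).left z'))

/-- An orbit is the image of the orbit map of any of its rational points; it suffices that the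
orbit of the rational point meets the given one. -/
theorem IsOrbit.range_eq {G X T : Over (Spec (.of k))} [GrpObj G] {act : G ⊗ X ⟶ X}
    (hact : IsGroupAction act) {i : T ⟶ X} (hT : IsOrbit act i)
    (x : 𝟙_ (Over (Spec (.of k))) ⟶ X)
    (h : (Set.range i.left ∩ Set.range (lift (𝟙 G) (toUnit G ≫ x) ≫ act).left).Nonempty) :
    Set.range (lift (𝟙 G) (toUnit G ≫ x) ≫ act).left = Set.range i.left := by
  obtain ⟨_, ⟨τ, hτ⟩, α, hα⟩ := h
  set φ := lift (𝟙 G) (toUnit G ≫ x) ≫ act with hφ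
  refine subset_antisymm ?_ ?_
  -- Applying the inverse of the group coordinate to `φ` recovers `x`, so `x` lies in the orbit. The
  -- constant morphism to `x` has a one-point image, hence `α` may be replaced by any `β`.
  · have h1 : (toUnit G ≫ x).left α ∈ Set.range i.left := by
      have h2 := hT.act_mem_range ((lift (𝟙 G)⁻¹ φ).left α) (by
        rw [← Scheme.Hom.comp_apply, ← Over.comp_left, lift_snd]
        exact ⟨τ, hτ.trans hα.symm⟩)
      rwa [← Scheme.Hom.comp_apply, ← Over.comp_left, hφ, hact.inv_act] at h2
    rintro _ ⟨β, rfl⟩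
    refine hT.act_mem_range ((lift (𝟙 G) (toUnit G ≫ x)).left β) ?_
    rw [← Scheme.Hom.comp_apply, ← Over.comp_left, lift_snd, left_toUnit_comp_eq x β α]
    exact h1
  · rintro _ ⟨τ', rfl⟩
    obtain ⟨actT, hactT, hsurj⟩ := hT.transitive
    have hpt : T.hom τ' = T.hom τ := by
      have : Subsingleton (Spec (.of k)) := inferInstanceAs (Subsingleton (PrimeSpectrum k))
      exact Subsingleton.elim _ _
    -- A point of `T × T` over `τ'` and `τ` lifts to `G × T` by transitivity. As `τ` has the same
    -- image in `X` as `α`, the resulting point of `G × X` lifts to `G × G`, where acting after `φ`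
    -- is multiplying before `φ`.
    obtain ⟨y, hy1, hy2⟩ := Scheme.Pullback.exists_preimage_pullback τ' τ hpt
    obtain ⟨z, hz⟩ := hsurj.1 y
    have h1 : actT.left z = τ' := by
      rw [← hy1, ← hz]
      exact congr(($(lift_fst actT (snd G T)).left z)).symm
    have h2 : (snd G T).left z = τ := by
      rw [← hy2, ← hz]
      exact congr(($(lift_snd actT (snd G T)).left z)).symm
    have h3 : (snd G X).left ((G ◁ i).left z) = φ.left α := by
      rw [← Scheme.Hom.comp_apply, ← Over.comp_left, whiskerLeft_snd, hα, ← hτ, ← h2]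
      rfl
    obtain ⟨z', hz', -⟩ := exists_whiskerLeft_eq G φ _ α h3
    refine ⟨μ[G].left z', ?_⟩
    have h4 : (G ◁ φ) ≫ act = μ[G] ≫ φ := by
      have : G ◁ φ = lift (fst G G) (snd G G ≫ φ) :=
        CartesianMonoidalCategory.hom_ext _ _ (by simp) (by simp)
      rw [this, hφ, comp_lift_assoc, comp_lift_assoc, ← hact.mul_act]
      simp [MonObj.mul_eq_mul]
    have h5 : i.left τ' = act.left ((G ◁ i).left z) := by
      rw [← h1, ← Scheme.Hom.comp_apply, ← Scheme.Hom.comp_apply, ← Over.comp_left,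
        ← Over.comp_left, hactT]
    rw [h5, ← hz', ← Scheme.Hom.comp_apply, ← Scheme.Hom.comp_apply, ← Over.comp_left,
      ← Over.comp_left, h4]

end Orbit

/-! ### Construction of the equivariant projection -/

section Projection

variable {k : Type u} [Field k]
variable {A A₀ N W X : Over (Spec (.of k))} [GrpObj A] [GrpObj A₀] [MonObj W]
variable {κ : N ⟶ A} {ρ : A ⟶ A₀} {act : A ⊗ X ⟶ X} {ρbar : X ⟶ A₀} {ε : N ⟶ W} {c : W ⟶ X}

/-- Sections of `ρ` over an open cover of `A₀` cover the union of the orbits through the fibre. -/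
theorem IsEquivariantFibre.exists_mem_range (hF : IsEquivariantFibre κ ρ act ρbar ε c)
    (z : (A ⊗ W).left) (V : A₀.left.Opens) (hz : (fst A W ≫ ρ).left z ∈ V) (s : openSub V ⟶ A)
    (hs : s ≫ ρ = openSubι V) :
    ((A ◁ c) ≫ act).left z ∈ Set.range ((s ▷ W) ≫ (A ◁ c) ≫ act).left := by
  let B : (A ⊗ W).left.Opens := (fst A W ≫ ρ).left ⁻¹ᵁ V
  obtain ⟨v, hv⟩ := exists_lift_openSub V (openSubι B ≫ fst A W ≫ ρ) (by
    rintro _ ⟨b, rfl⟩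
    exact b.2)
  -- Over `V` one has `a = s(ρ(a)) κ(t)`, so `a c(w) = s(ρ(a)) c(ε(t) w)`.
  obtain ⟨t, ht⟩ := hF.exists_kernel_lift (openSubι B ≫ fst A W) (v ≫ s) (by simp [hs, hv])
  have h : openSubι B ≫ (A ◁ c) ≫ act =
      lift v ((t ≫ ε) * (openSubι B ≫ snd A W)) ≫ (s ▷ W) ≫ (A ◁ c) ≫ act := by
    rw [lift_whiskerRight_assoc, ← hF.lift_mul_comp, ht, ← comp_lift, lift_fst_snd,
      Category.comp_id]
  refine ⟨(lift v ((t ≫ ε) * (openSubι B ≫ snd A W))).left ⟨z, hz⟩, ?_⟩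
  exact congr(($h).left ⟨z, hz⟩).symm

/-- Multiplication by the idempotent `w₀` on the fibre is spread out by `A`. The hypothesis `hrange`
puts the values of the projection in the single orbit of `c(w₀)`, and `hmeet` identifies that orbit
with `T`. -/
theorem exists_equivariant_projection
    (hF : IsEquivariantFibre κ ρ act ρbar ε c)
    (hA : IsReduced A.left) (hX : IsReduced X.left) (hXs : IsSeparated X.hom)
    (w₀ : 𝟙_ (Over (Spec (.of k))) ⟶ W) (hw₀ : w₀ * w₀ = w₀)
    (hrange : Set.range (𝟙 W * (toUnit W ≫ w₀)).left ⊆ Set.range (ε * (toUnit N ≫ w₀)).left)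
    (V : A₀.left → A₀.left.Opens) (hV : ∀ x, x ∈ V x) (s : ∀ x, openSub (V x) ⟶ A)
    (hs : ∀ x, s x ≫ ρ = openSubι (V x))
    (hopen : ∀ x, IsOpenImmersion ((s x ▷ W) ≫ (A ◁ c) ≫ act).left)
    {T : Over (Spec (.of k))} (i : T ⟶ X) (hT : IsOrbit act i)
    (hmeet : (Set.range i.left ∩
      Set.range ((A ◁ (ε * (toUnit N ≫ w₀))) ≫ (A ◁ c) ≫ act).left).Nonempty) :
    ∃ U : X.left.Opens, Set.range ((A ◁ c) ≫ act).left ⊆ U ∧ Set.range i.left ⊆ U ∧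
      ∃ p : openSub U ⟶ T, IsEquivariantMap act i p ∧
        ∃ iU : T ⟶ openSub U, iU ≫ openSubι U = i ∧ iU ≫ p = 𝟙 T := by
  set q := (A ◁ c) ≫ act with hq
  set m : W ⟶ W := 𝟙 W * (toUnit W ≫ w₀) with hm
  have hact := hF.isGroupAction
  have hq_lift {Z : Over (Spec (.of k))} (a : Z ⟶ A) (w : Z ⟶ W) :
      lift a w ≫ q = lift a (w ≫ c) ≫ act := by rw [hq, lift_whiskerLeft_assoc]
  have hcomp_m {Z : Over (Spec (.of k))} (w : Z ⟶ W) : w ≫ m = w * (toUnit Z ≫ w₀) := by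
    rw [hm, MonObj.comp_mul, Category.comp_id, comp_toUnit_assoc]
  have hm_lift {Z : Over (Spec (.of k))} (a : Z ⟶ A) (w : Z ⟶ W) :
      lift a w ≫ (A ◁ m) ≫ q = lift a (w * (toUnit Z ≫ w₀)) ≫ q := by
    rw [lift_whiskerLeft_assoc, hcomp_m]
  have hq_act {Z : Over (Spec (.of k))} (a b : Z ⟶ A) (w : Z ⟶ W) :
      lift a (lift b w ≫ q) ≫ act = lift (a * b) w ≫ q := by
    rw [hq_lift, hq_lift, hact.mul_act]
  -- the orbit of the image of `w₀`
  set φ : A ⟶ X := lift (𝟙 A) (toUnit A ≫ w₀ ≫ c) ≫ act with hφ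
  have hφq : φ = lift (𝟙 A) (toUnit A ≫ w₀) ≫ q := by rw [hq_lift, hφ, Category.assoc]
  have hN : (A ◁ (ε * (toUnit N ≫ w₀))) ≫ q = (fst A N * (snd A N ≫ κ)) ≫ φ := by
    rw [hφq, comp_lift_assoc, Category.comp_id, hq, hF.lift_mul_comp]
    congr 1
    refine CartesianMonoidalCategory.hom_ext _ _ (by simp) ?_
    simp [MonObj.comp_mul]
  have hNφ : Set.range ((A ◁ (ε * (toUnit N ≫ w₀))) ≫ q).left ⊆ Set.range φ.left := by
    rw [hN]
    exact range_left_comp_subset _ _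
  have hφi : Set.range φ.left = Set.range i.left :=
    hT.range_eq hact (w₀ ≫ c) (hmeet.mono (Set.inter_subset_inter_right _ hNφ))
  -- the projection, with values in `X`
  obtain ⟨U, q', hU, hq', hepi, hdesc⟩ :=
    exists_open_range_of_local_sections q (fun x => s x ▷ W) hopen (by
      rintro _ ⟨z, rfl⟩
      exact ⟨_, hF.exists_mem_range z _ (hV _) _ (hs _)⟩)
  obtain ⟨p, hp⟩ := hdesc X ((A ◁ m) ≫ q) (by
    intro Y a b hab
    have ha (a : Y ⟶ A ⊗ W) : a = lift (a ≫ fst A W) (a ≫ snd A W) := by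
      rw [← comp_lift, lift_fst_snd, Category.comp_id]
    rw [ha a, ha b] at hab ⊢
    rw [hm_lift, hm_lift]
    exact hF.comp_eq_of_comp_eq _ _ _ _ _ hab)
  have hp_lift {Z : Over (Spec (.of k))} (a : Z ⟶ A) (w : Z ⟶ W) :
      lift a w ≫ q' ≫ p = lift a (w * (toUnit Z ≫ w₀)) ≫ q := by
    rw [hp, hm_lift]
  have hsurj : Function.Surjective q'.left := by
    rintro ⟨x, hx⟩
    obtain ⟨z, hz⟩ := hU.le hx
    refine ⟨z, Subtype.ext ?_⟩
    exact congr(($hq').left z).trans hz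
  -- By `hrange`, a value `a c(w w₀)` is also attained with the fibre coordinate in `N w₀`, hence
  -- lies in the image of `φ`.
  have hpi : Set.range p.left ⊆ Set.range i.left := by
    rintro _ ⟨x, rfl⟩
    obtain ⟨z, rfl⟩ := hsurj x
    rw [← hφi]
    refine hNφ ?_
    obtain ⟨t, ht⟩ := hrange ⟨(snd A W).left z, rfl⟩
    obtain ⟨z', hz', -⟩ := exists_whiskerLeft_eq A (ε * (toUnit N ≫ w₀)) ((A ◁ m).left z) t (by
      rw [ht, ← Scheme.Hom.comp_apply, ← Scheme.Hom.comp_apply, ← Over.comp_left, ← Over.comp_left,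
        whiskerLeft_snd])
    refine ⟨z', ?_⟩
    have := congr(($hp).left z)
    rw [Over.comp_left, Scheme.Hom.comp_apply, Over.comp_left, Scheme.Hom.comp_apply] at this
    rw [this, ← hz']
    rfl
  have hiU : Set.range i.left ⊆ U := by
    rw [hU, ← hφi, hφq]
    exact range_left_comp_subset _ _
  have hi : Mono i := mono_of_left i (have := hT.immersion; inferInstance)
  have hιU : Mono (openSubι U) := mono_of_left _ (inferInstanceAs (Mono U.ι))
  obtain ⟨pT, hpT⟩ := exists_lift_immersion i hT.immersion (inferInstanceAs (IsReduced U)) p hpi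
  obtain ⟨iU, hiU'⟩ := exists_lift_openSub U i hiU
  obtain ⟨φT, hφT⟩ := exists_lift_immersion i hT.immersion hA φ hφi.le
  refine ⟨U, hU.ge, hiU, pT, ?_, iU, hiU', ?_⟩
  · obtain ⟨actT, hactT, -⟩ := hT.transitive
    have hwhisker {Z : Over (Spec (.of k))} (f : A ⊗ W ⟶ Z) :
        A ◁ f = lift (fst _ _) (lift (snd _ _ ≫ fst _ _) (snd _ _ ≫ snd _ _) ≫ f) := by
      refine CartesianMonoidalCategory.hom_ext _ _ (by simp) ?_
      rw [whiskerLeft_snd, lift_snd, ← comp_lift, lift_fst_snd, Category.comp_id]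
    have h : (A ◁ q') ≫ (A ◁ openSubι U) ≫ act =
        lift (fst _ _ * (snd _ _ ≫ fst _ _)) (snd _ _ ≫ snd _ _) ≫ q := by
      rw [← MonoidalCategory.whiskerLeft_comp_assoc, hq', hwhisker, hq_act]
    have hUact : Set.range ((A ◁ openSubι U) ≫ act).left ⊆ U := by
      rintro _ ⟨z, rfl⟩
      obtain ⟨y, hy⟩ := hsurj ((snd A (openSub U)).left z)
      obtain ⟨z', rfl, -⟩ := exists_whiskerLeft_eq A q' z y hy.symm
      rw [hU]
      exact ⟨_, congr(($h).left z').symm⟩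
    obtain ⟨actU, hactU⟩ := exists_lift_openSub U ((A ◁ openSubι U) ≫ act) hUact
    -- Equivariance is tested after `A ◁ q'`, where both sides become `(b, a, w) ↦ b a c(w w₀)`.
    refine ⟨actU, actT, hactU, hactT, hepi _ _ _ _ ?_⟩
    have h1 : (A ◁ q') ≫ actU =
        lift (fst _ _ * (snd _ _ ≫ fst _ _)) (snd _ _ ≫ snd _ _) ≫ q' := by
      rw [← cancel_mono (openSubι U), Category.assoc, Category.assoc, hactU, h, hq']
    rw [reassoc_of% h1, ← cancel_mono i, Category.assoc, Category.assoc, Category.assoc,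
      Category.assoc, hpT, hp_lift, hactT, ← MonoidalCategory.whiskerLeft_comp_assoc,
      ← MonoidalCategory.whiskerLeft_comp_assoc, Category.assoc, hpT, hwhisker, hp_lift, hq_act]
  · have hTs : IsSeparated T.hom := by
      rw [← Over.w i]
      have := hT.immersion
      infer_instance
    have hTr := hT.reduced
    -- The orbit map is surjective onto the reduced `T`, so it suffices to compare after it: `a
    -- c(w₀)` goes to `a c(w₀ w₀) = a c(w₀)`.
    have hdom : IsDominant φT.left := by
      refine ⟨Function.Surjective.denseRange fun t => ?_⟩
      obtain ⟨a, ha⟩ := hφi.ge ⟨t, rfl⟩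
      have := hT.immersion
      refine ⟨a, i.left.isEmbedding.injective ?_⟩
      rw [← ha, ← hφT]
      rfl
    have h : φT ≫ iU ≫ pT = φT ≫ 𝟙 T := by
      rw [← cancel_mono i]
      have h1 : φT ≫ iU = lift (𝟙 A) (toUnit A ≫ w₀) ≫ q' := by
        rw [← cancel_mono (openSubι U), Category.assoc, Category.assoc, hiU', hq', hφT, hφq]
      rw [Category.comp_id, hφT, reassoc_of% h1, Category.assoc, Category.assoc, hpT, hp_lift,
        ← MonObj.comp_mul, hw₀, hφq]
    ext1
    exact ext_of_isDominant_of_isSeparated T.hom ((Over.w _).trans (Over.w _).symm) φT.left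
      (by simpa using congr($(h).left))

end Projection

/-! ### Finiteness of the set of lattice points -/

/-- Finiteness makes the monoids of the toric charts finitely generated, as
`exists_localization_monomials` requires. -/
theorem finite_latticePoints {r : ℕ} {Q : Set (Fin r → ℝ)} (hQ : Bornology.IsBounded Q) :
    (latticePoints Q).Finite := by
  obtain ⟨R, hR⟩ := hQ.exists_norm_le
  refine (Set.finite_Icc (fun _ => -⌈R⌉) (fun _ => ⌈R⌉)).subset fun m hm => ?_
  have h (i : Fin r) : |m i| ≤ ⌈R⌉ := by
    have h1 : |(m i : ℝ)| ≤ R := (norm_le_pi_norm (toReal m) i).trans (hR _ hm)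
    exact_mod_cast h1.trans (Int.le_ceil R)
  exact ⟨fun i => (abs_le.1 (h i)).1, fun i => (abs_le.1 (h i)).2⟩

theorem isBounded_newtonPolyhedron {k : Type u} [Field k] {r : ℕ}
    (f : AddMonoidAlgebra k (Fin r → ℤ)) : Bornology.IsBounded (newtonPolyhedron f) := by
  rw [newtonPolyhedron, isBounded_convexHull]
  refine (Set.Finite.image _ ?_).isBounded
  exact f.coeff.support.finite_toSet.subset fun m hm => Finsupp.mem_support_iff.2 hm

/-! ### The fibre of the completion over the origin -/

section Completion

variable {k : Type u} [Field k] {A A₀ N Gbar : Over (Spec (.of k))} [GrpObj A] [GrpObj A₀]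

/-- A morphism from an equivariant completion of `A` extending a homomorphism from `A` is
compatible with the group laws. -/
theorem EquivariantCompletion.lift_act_comp (X : EquivariantCompletion A)
    (hA : QuasiCompact A.hom) (hA₀ : IsSeparated A₀.hom) (ρ : A ⟶ A₀) (hρ : IsMonHom ρ)
    (ρbar : X.X ⟶ A₀) (hj : X.j ≫ ρbar = ρ) {Z : Over (Spec (.of k))} (a : Z ⟶ A) (x : Z ⟶ X.X) :
    lift a x ≫ X.act ≫ ρbar = (a ≫ ρ) * (x ≫ ρbar) := by
  have := X.quasiCompact_j hA
  have := X.isSchemeTheoreticallyDominant_j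
  have h : X.act ≫ ρbar = (fst _ _ ≫ ρ) * (snd _ _ ≫ ρbar) := by
    refine Over.hom_ext_of_dominant (A ◁ X.j) hA₀ ?_
    rw [reassoc_of% X.act_extends, hj, MonObj.comp_mul, whiskerLeft_fst_assoc,
      whiskerLeft_snd_assoc, hj, IsMonHom.mul_hom, ← MonObj.mul_comp, Hom.mul_def]
    simp [MonObj.mul_eq_mul, MonObj.mul_comp, MonObj.comp_mul]
  rw [h, MonObj.comp_mul, lift_fst_assoc, lift_snd_assoc]

/-- The fibre at the origin of a completion which is locally trivial over `A₀`. -/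
theorem EquivariantCompletion.exists_fibre (X : EquivariantCompletion A)
    (hA : QuasiCompact A.hom) (hA₀ : IsSeparated A₀.hom) (κ : N ⟶ A) (ρ : A ⟶ A₀)
    (hρ : IsMonHom ρ) (ρbar : X.X ⟶ A₀) (hj : X.j ≫ ρbar = ρ) (e : N ⟶ Gbar)
    [IsSchemeTheoreticallyDominant e.left] [QuasiCompact e.left]
    (hloc : ∀ x : A₀.left, ∃ V : A₀.left.Opens, x ∈ V ∧
      ∃ (s : openSub V ⟶ A) (c : openSub V ⊗ Gbar ⟶ X.X),
        s ≫ ρ = openSubι V ∧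
        (openSub V ◁ e) ≫ c = (s ⊗ₘ κ) ≫ μ[A] ≫ X.j ∧
        IsPullback c (fst (openSub V) Gbar) ρbar (openSubι V)) :
    ∃ c₀ : Gbar ⟶ X.X, Mono c₀ ∧ c₀ ≫ ρbar = 1 ∧ e ≫ c₀ = κ ≫ X.j ∧
      ∀ (V : A₀.left.Opens) (s : openSub V ⟶ A) (c : openSub V ⊗ Gbar ⟶ X.X),
        (openSub V ◁ e) ≫ c = (s ⊗ₘ κ) ≫ μ[A] ≫ X.j → c = (s ▷ Gbar) ≫ (A ◁ c₀) ≫ X.act := by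
  have hact := X.isGroupAction hA
  obtain ⟨V, hV, s, c, hs, hc, hpb⟩ := hloc (η[A₀].left (IsLocalRing.closedPoint k))
  obtain ⟨z, hz⟩ := exists_lift_openSub V η[A₀] (by
    rintro _ ⟨x, rfl⟩
    have : Subsingleton (𝟙_ (Over (Spec (.of k)))).left :=
      inferInstanceAs (Subsingleton (PrimeSpectrum k))
    rwa [Subsingleton.elim x (IsLocalRing.closedPoint k : PrimeSpectrum k)])
  have hmono : Mono (openSubι V) := mono_of_left _ (inferInstanceAs (Mono V.ι))
  have hcmono : Mono c := (MorphismProperty.monomorphisms _).of_isPullback hpb.flip hmono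
  -- `x` parametrizes the fibre over the origin through the trivialization, so it is off by the
  -- translation `s(0)`. Undoing this makes `c₀` extend `κ`, independently of the section; by
  -- density of the torus, `c₀` then recovers every other trivialization.
  let x : Gbar ⟶ X.X := lift (toUnit Gbar ≫ z) (𝟙 Gbar) ≫ c
  let c₀ : Gbar ⟶ X.X := lift (toUnit Gbar ≫ z ≫ s)⁻¹ x ≫ X.act
  have hx : lift (toUnit Gbar ≫ z ≫ s) c₀ ≫ X.act = x := by
    have := hact.inv_act (toUnit Gbar ≫ z ≫ s)⁻¹ x
    rwa [inv_inv] at this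
  have he : e ≫ c₀ = κ ≫ X.j := by
    have hex : e ≫ x = ((toUnit N ≫ z ≫ s) * κ) ≫ X.j := by
      have : lift (toUnit N ≫ z) (𝟙 N) ≫ (openSub V ◁ e) ≫ c =
          ((toUnit N ≫ z ≫ s) * κ) ≫ X.j := by
        rw [hc, lift_map_assoc, Hom.mul_def]
        simp
      rw [← this, lift_whiskerLeft_assoc, comp_lift_assoc, comp_toUnit_assoc, Category.comp_id,
        Category.id_comp]
    rw [comp_lift_assoc, GrpObj.comp_inv, comp_toUnit_assoc, hex, X.lift_comp_act,
      inv_mul_cancel_left]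
  refine ⟨c₀, ⟨fun {Z} g h H => ?_⟩, ?_, he, fun V' s' c' hc' => ?_⟩
  · have key (g : Z ⟶ Gbar) : g ≫ x = lift (toUnit _ ≫ z) g ≫ c := by
      rw [comp_lift_assoc, comp_toUnit_assoc, Category.comp_id]
    have key' (g : Z ⟶ Gbar) : g ≫ x = lift (g ≫ toUnit Gbar ≫ z ≫ s) (g ≫ c₀) ≫ X.act := by
      rw [← comp_lift_assoc, hx]
    have H' : g ≫ x = h ≫ x := by
      rw [key', key', H, comp_toUnit_assoc, comp_toUnit_assoc]
    rw [key, key, cancel_mono] at H'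
    simpa using congr($H' ≫ snd _ _)
  · have h1 : x ≫ ρbar = toUnit _ ≫ η[A₀] := by
      rw [Category.assoc, hpb.w, lift_fst_assoc, Category.assoc, hz]
    have h2 := X.lift_act_comp hA hA₀ ρ hρ ρbar hj (toUnit Gbar ≫ z ≫ s)⁻¹ x
    rw [Category.assoc, h2, GrpObj.inv_comp, h1, Category.assoc, Category.assoc, hs, hz,
      inv_mul_cancel]
  · refine Over.hom_ext_of_dominant (openSub V' ◁ e) X.variety.separated ?_
    have h1 : (openSub V' ◁ e) ≫ (s' ▷ Gbar) ≫ (A ◁ c₀) ≫ X.act =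
        lift (fst _ _ ≫ s') ((snd _ _ ≫ κ) ≫ X.j) ≫ X.act := by
      rw [Category.assoc (snd _ _), ← he, ← Category.assoc, ← Category.assoc]
      congr 1
      exact CartesianMonoidalCategory.hom_ext _ _ (by simp) (by simp)
    rw [hc', h1, X.lift_comp_act, Hom.mul_def, Category.assoc]
    congr 1

end Completion

/-- The embedding of an affine toric chart into the fibre at the origin is equivariant. -/
theorem EquivariantCompletion.isEquivariantFibre {k : Type u} [Field k]
    {A A₀ N W : Over (Spec (.of k))} [GrpObj A] [GrpObj A₀] [GrpObj N] [MonObj W]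
    (X : EquivariantCompletion A)
    (hA : QuasiCompact A.hom) (hA₀ : IsSeparated A₀.hom) (κ : N ⟶ A) (hκ : IsMonHom κ) (ρ : A ⟶ A₀)
    (hρ : IsMonHom ρ) (hker : IsPullback κ (toUnit N) ρ η[A₀]) (ρbar : X.X ⟶ A₀)
    (hj : X.j ≫ ρbar = ρ) (ε : N ⟶ W) [IsMonHom ε]
    [IsSchemeTheoreticallyDominant ε.left] [QuasiCompact ε.left] (c : W ⟶ X.X) (hc : Mono c)
    (hcρ : c ≫ ρbar = 1) (hεc : ε ≫ c = κ ≫ X.j) :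
    IsEquivariantFibre κ ρ X.act ρbar ε c where
  isGroupAction := X.isGroupAction hA
  isMonHom := hρ
  kernel := hker
  act_comp := X.lift_act_comp hA hA₀ ρ hρ ρbar hj
  comp := hcρ
  mono := hc
  equivariant {Z} t w := by
    -- On the dense `N × N` both sides are the product in `N` followed by `κ` and the inclusion of
    -- `A`.
    have h : lift (fst N W ≫ κ) (snd N W ≫ c) ≫ X.act = ((fst N W ≫ ε) * snd N W) ≫ c := by
      refine Over.hom_ext_of_dominant (N ◁ ε) X.variety.separated ?_
      rw [comp_lift_assoc, whiskerLeft_fst_assoc, whiskerLeft_snd_assoc, hεc, ← Category.assoc _ κ,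
        X.lift_comp_act, ← MonObj.mul_comp, ← Category.assoc, MonObj.comp_mul,
        whiskerLeft_fst_assoc, whiskerLeft_snd, ← MonObj.mul_comp, Category.assoc, Category.assoc,
        hεc]
    have h1 := congr(lift t w ≫ $h)
    rwa [comp_lift_assoc, lift_fst_assoc, lift_snd_assoc, ← Category.assoc, MonObj.comp_mul,
      lift_fst_assoc, lift_snd] at h1

/-! ### The projection onto an orbit of the Newton completion -/

theorem proposition2p5 {k : Type u} [Field k] [CharZero k] {r : ℕ}
    {A A₀ : Over (Spec (.of k))} [GrpObj A] [GrpObj A₀]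
    (κ : splitTorus k r ⟶ A) (ρ : A ⟶ A₀) (hA : IsSemiabelian κ ρ)
    (f : AddMonoidAlgebra k (Fin r → ℤ)) (hf : affineSpan ℝ (newtonPolyhedron f) = ⊤)
    (Abar : EquivariantCompletion A) (hAbar : IsNewtonCompletion κ ρ f hf Abar)
    {T : Over (Spec (.of k))} (i : T ⟶ Abar.X) (hT : IsOrbit Abar.act i) :
    ∃ U : Abar.X.left.Opens,
      Set.range Abar.j.left ⊆ U ∧ Set.range i.left ⊆ U ∧
      ∃ p : openSub U ⟶ T, IsEquivariantMap Abar.act i p ∧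
        ∃ iU : T ⟶ openSub U, iU ≫ openSubι U = i ∧ iU ≫ p = 𝟙 T := by

  obtain ⟨n, -, -, ρbar, hj, hloc⟩ := hAbar
  have hκ := hA.isMonHom_κ
  have hρ := hA.isMonHom_ρ
  have hAqc := hA.variety.quasiCompact
  have hAint := hA.variety.integral
  have hX := Abar.variety.integral
  have hA₀ : IsSeparated A₀.hom := hA.abelian.proper.toIsSeparated
  have hfin : (latticePoints ((n : ℝ) • newtonPolyhedron f)).Finite :=
    finite_latticePoints ((isBounded_newtonPolyhedron f).smul₀ _)
  obtain ⟨c₀, hmono, hc₀ρ, hec₀, htriv⟩ :=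
    Abar.exists_fibre hAqc hA₀ κ ρ hρ ρbar hj _ hloc
  choose V hV s c hs hc hpb using hloc
  have hcc₀ (x : A₀.left) : c x = (s x ▷ _) ≫ (A ◁ c₀) ≫ Abar.act := htriv _ _ _ (hc x)
  obtain ⟨τ⟩ := hT.nonempty
  -- a toric chart whose closed torus orbit meets the given orbit
  set x := ρbar.left (i.left τ) with hx
  obtain ⟨ζ, hζ⟩ : i.left τ ∈ Set.range (c x).left := by
    have h := (hpb x).map (Over.forget _)
    obtain ⟨w, hw, -⟩ := Scheme.Pullback.exists_preimage_pullback (f := ρbar.left)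
      (g := (openSubι (V x)).left) (i.left τ) (⟨x, hV x⟩ : V x) rfl
    exact ⟨h.isoPullback.inv w, by
      rw [← hw]
      exact congr($(h.isoPullback_inv_fst) w)⟩
  obtain ⟨S, o, y, ho, hεo, hoy, hy⟩ := exists_toric_chart k (latticePoints_nonempty hf n) hfin
    ((snd (openSub (V x)) _).left ζ)
  have ho' : Mono o := mono_of_left o inferInstance
  have hF := Abar.isEquivariantFibre hAqc hA₀ κ hκ ρ hρ hA.kernel ρbar hj (torusToSpec k S)
    (o ≫ c₀) (mono_comp _ _) (by rw [Category.assoc, hc₀ρ, MonObj.comp_one])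
    (by rw [reassoc_of% hεo, hec₀])
  have hchart (x : A₀.left) : (s x ▷ _) ≫ (A ◁ (o ≫ c₀)) ≫ Abar.act = (_ ◁ o) ≫ c x := by
    rw [hcc₀, MonoidalCategory.whiskerLeft_comp_assoc, ← whisker_exchange_assoc]
  obtain ⟨U, h1, h2, h3⟩ := exists_equivariant_projection hF inferInstance inferInstance
    Abar.variety.separated (distinguishedPoint k S) (distinguishedPoint_mul_self S)
    (range_id_mul_subset S) V hV s hs
    (fun x => by
      have := (hpb x).map (Over.forget _)
      have h1 : IsOpenImmersion (c x).left :=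
        MorphismProperty.of_isPullback this.flip (inferInstanceAs (IsOpenImmersion (V x).ι))
      have h2 : IsOpenImmersion (openSub (V x) ◁ o).left :=
        MorphismProperty.of_isPullback (isPullback_whiskerLeft_snd_left _ o).flip ho
      rw [hchart, Over.comp_left]
      infer_instance) i hT ⟨i.left τ, ⟨τ, rfl⟩, by
      -- The chart was chosen so that `y` lies in `N w₀`; hence `ζ` lifts to `V × N`, and the
      -- section carries the lift to `A × N`.
      obtain ⟨t, ht⟩ := mem_range_torusToSpec_mul S y hy
      obtain ⟨ζ', hζ', hζy⟩ := exists_whiskerLeft_eq _ o ζ y hoy.symm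
      obtain ⟨ζ'', hζ'', -⟩ := exists_whiskerLeft_eq _
        (torusToSpec k S * (toUnit _ ≫ distinguishedPoint k S)) ζ' t (hζy.trans ht.symm)
      refine ⟨(s x ▷ _).left ζ'', ?_⟩
      have h := hchart x
      rw [← hζ, ← hζ', ← hζ'']
      have h' := congr((openSub (V x) ◁
        (torusToSpec k S * (toUnit _ ≫ distinguishedPoint k S))) ≫ $h)
      rw [whisker_exchange_assoc] at h'
      exact congr(($h').left ζ'')⟩
  refine ⟨U, subset_trans ?_ h1, h2, h3⟩
  -- A point `a` of `A` is `a c(1)`, so `A` lies in the image of `A × W`.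
  have hone : lift (𝟙 A) 1 ≫ (A ◁ (o ≫ c₀)) ≫ Abar.act = Abar.j := by
    have h4 : (1 : A ⟶ specMonoidAlgebra k S) ≫ o ≫ c₀ = (1 : A ⟶ A) ≫ Abar.j := by
      rw [← MonObj.one_comp (torusToSpec k S), Category.assoc, reassoc_of% hεo, hec₀,
        ← Category.assoc, MonObj.one_comp]
    rw [lift_whiskerLeft_assoc, h4, Abar.lift_comp_act, _root_.mul_one, Category.id_comp]
  rw [← hone]
  exact range_left_comp_subset _ _
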